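/- Let $n\ge 5$ be odd and let $q$ be a prime power. Put $y:=q^{n-2}+q^{n-4}+\dots+q^3+1$ and $$ M=q^{n^2-n} + \sum_{r=2}^{n-2} \genfrac{[}{]}{0pt}{}{n}{r}_q\sum_{j=2}^{r} (-1)^{r-j} \genfrac{[}{]}{0pt}{}{r}{j}_q q^{\binom{r-j}{2}}(q^{n(j-1)}-1) + \prod_{i=1}^{n-1} (q^i+1) - 2 q^{\frac{n(n-1)}{2}} + q^{\frac{(n-1)(n-3)}{4}} \prod_{i=1}^{\frac{n-1}{2}} (q^{2i+1}-1)+y(y-1) + 1 , $$ where $\genfrac{[}{]}{0pt}{}{a}{b}_q=\frac{(q^a-1)\cdots(q^{a-b+1}-1)}{(q^b-1)\cdots(q-1)}$. Then $y$ is the maximum size of a partial line spread (set of pairwise disjoint lines) of $\mathrm{PG}(n-1,q)$, and there exists a $(2n,M,4;n)_q$ constant-dimension subspace code, that is, a set of exactly $M$ subspaces of dimension $n$ of $\mathrm{GF}(q)^{2n}$ whose minimum distance with respect to $d_s(U,U')=\dim(U+U')-\dim(U\cap U')$ is $4$. More precisely, let $\mathcal Q=\mathcal Q^+(2n-1,q)$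 be the hyperbolic quadric $X_1X_{n+1}+\dots+X_nX_{2n}=0$ of $\mathrm{PG}(2n-1,q)$ with polarity $\perp$, let $S: X_1=\dots=X_n=0$ and $S': X_{n+1}=\dots=X_{2n}=0$, and for an $n\times n$ matrix $A$ let $L(A)$ and $L'(A)$ be the row spaces of $(I_n\,|\,A)$ and $(A\,|\,I_n)$. There are a linear MRD code $\mathcal M$ of $n\times n$ matrices over $\mathrm{GF}(q)$ (with $|\mathcal M|=q^{n^2-n}$ and minimum rank distance $2$) that contains all skew-symmetric matrices (with zero diagonal, also in characteristic $2$), and a partial line spread $\mathcal P$ of $S$ with $|\mathcal P|=y$, such that the following subspaces together form such a code: (1) the $L(A)$ with $A\in\mathcal M$ not skew-symmetric; (2) the $L'(A)$ with $A\in\mathcal M$ and $2\le \operatorname{rk} A\le n-2$; (3) the generators of $\mathcal Q$ in the same system as $S$ that either are disjoint from $S'$ and meet $S$ in exactly one point, or meet both $S$ and $S'$ non-trivially; (4) $S$; (5) the spaces $\langle \ell,\, m^\perp\cap S'\rangle$ with $\ell\ne m$ in $\mathcal P$; there are exactly $y(y-1)$ of these, and none of them is among (1)-(4). -/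

import Mathlib

namespace SubspaceCode

open Module

/-! ### Constant-dimension subspace codes -/

section Codes

variable {F V : Type*} [Field F] [AddCommGroup V] [Module F V]

/-- The subspace distance `dim (U + U') - dim (U ∩ U')`.  In a finite-dimensional space
`dim (U ∩ U') ≤ dim (U + U')`, so the subtraction of natural numbers is not truncated. -/
noncomputable def subspaceDist (U U' : Submodule F V) : ℕ :=
  finrank F ↥(U ⊔ U') - finrank F ↥(U ⊓ U')

/-- `C` is an `(r, M, d; k)_q` constant-dimension subspace code, where `q = |F|`: a set of `M`
subspaces of dimension `k` of the `r`-dimensional space `V`, with minimum subspace distance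
equal to `d`. -/
structure IsConstantDimensionCode (C : Set (Submodule F V)) (r M d k : ℕ) : Prop where
  finrank_ambient : finrank F V = r
  finrank_mem : ∀ U ∈ C, finrank F U = k
  finite : C.Finite
  card : C.ncard = M
  minDist : IsLeast {t | ∃ U ∈ C, ∃ U' ∈ C, U ≠ U' ∧ subspaceDist U U' = t} d

/-- A partial line spread of (the projective space of) the subspace `W`: a set of mutually
disjoint projective lines, that is, of two-dimensional subspaces meeting pairwise in `0`. -/
def IsPartialLineSpread (W : Submodule F V) (P : Set (Submodule F V)) : Prop :=
  (∀ l ∈ P, l ≤ W ∧ finrank F l = 2) ∧ P.Pairwise Disjoint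

end Codes

/-! ### Rank-distance codes -/

section RankCodes

variable {F : Type*} [Field F] {n : ℕ}

/-- `A` is a maximum rank distance code of `n × n` matrices with minimum rank distance `d`:
its size is `q ^ (n * (n - d + 1))`, where `q = |F|`.  For `d = 2` this is an
`(n, n, n - 1)` MRD code. -/
structure IsMRD (A : Set (Matrix (Fin n) (Fin n) F)) (d : ℕ) : Prop where
  minDist : IsLeast {t | ∃ X ∈ A, ∃ Y ∈ A, X ≠ Y ∧ (X - Y).rank = t} d
  card : A.ncard = Nat.card F ^ (n * (n - d + 1))

/-- Skew-symmetric matrices; as usual the diagonal is required to be zero, which is automatic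
in odd characteristic. -/
def IsSkew (A : Matrix (Fin n) (Fin n) F) : Prop :=
  A.transpose = -A ∧ ∀ i, A i i = 0

end RankCodes

/-! ### The geometry of `PG(2n-1, q)` with two disjoint `(n-1)`-spaces `S`, `S'` -/

section Geometry

variable (F : Type*) [Field F] (n : ℕ)

/-- The `2n`-dimensional vector space underlying `PG(2n-1, q)`; the first component of a vector
holds its first `n` coordinates, the second component its last `n` coordinates. -/
abbrev Ambient : Type _ := (Fin n → F) × (Fin n → F)

/-- `S`: the first `n` coordinates vanish. -/
def spaceS : Submodule F (Ambient F n) := Submodule.prod ⊥ ⊤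

/-- `S'`: the last `n` coordinates vanish. -/
def spaceS' : Submodule F (Ambient F n) := Submodule.prod ⊤ ⊥

/-- The quadratic form `∑ i, X_i X_{n+i}` of the hyperbolic quadric `Q⁺(2n-1, q)`. -/
def hyperbolicForm : QuadraticForm F (Ambient F n) :=
  LinearMap.BilinMap.toQuadraticMap
    ((dotProductBilin F F).compl₁₂
      (LinearMap.fst F (Fin n → F) (Fin n → F)) (LinearMap.snd F (Fin n → F) (Fin n → F)))

theorem hyperbolicForm_apply (v : Ambient F n) :
    hyperbolicForm F n v = ∑ i, v.1 i * v.2 i := rfl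

variable {F n}

/-- The polar space `U^⊥` of `U` with respect to the orthogonal polarity of the quadric. -/
def perp (U : Submodule F (Ambient F n)) : Submodule F (Ambient F n) :=
  U.orthogonalBilin (hyperbolicForm F n).polarBilin

theorem mem_perp (U : Submodule F (Ambient F n)) (v : Ambient F n) :
    v ∈ perp U ↔
      ∀ u ∈ U, hyperbolicForm F n (u + v) - hyperbolicForm F n u - hyperbolicForm F n v = 0 :=
  Iff.rfl

/-- Generators (maximal totally singular subspaces) of `Q⁺(2n-1, q)`: the totally singular
subspaces of vector space dimension `n`. -/
def IsGenerator (U : Submodule F (Ambient F n)) : Prop :=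
  (∀ v ∈ U, hyperbolicForm F n v = 0) ∧ finrank F U = n

/-- Two generators belong to the same system when the codimension of their intersection in each
of them is even. -/
def SameSystem (U U' : Submodule F (Ambient F n)) : Prop :=
  Even (n - finrank F ↥(U ⊓ U'))

/-- `L(A)`: the row space of the `n × 2n` matrix `(I | A)`. -/
def liftL (A : Matrix (Fin n) (Fin n) F) : Submodule F (Ambient F n) :=
  Submodule.span F (Set.range fun i => ((Pi.single i 1, A i) : Ambient F n))

/-- `L'(A)`: the row space of the `n × 2n` matrix `(A | I)`. -/
def liftL' (A : Matrix (Fin n) (Fin n) F) : Submodule F (Ambient F n) :=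
  Submodule.span F (Set.range fun i => ((A i, Pi.single i 1) : Ambient F n))

/-- The lifted MRD code `{L(A) : A ∈ A₀}` with the lifted skew-symmetric part removed. -/
def liftedPart (A₀ : Set (Matrix (Fin n) (Fin n) F)) : Set (Submodule F (Ambient F n)) :=
  {U | ∃ A ∈ A₀, ¬ IsSkew A ∧ liftL A = U}

/-- The lifts `L'(A)` of the constant-rank codes formed by the matrices of rank `r` in `A₀`,
for `2 ≤ r ≤ n - 2`. -/
def constantRankPart (A₀ : Set (Matrix (Fin n) (Fin n) F)) : Set (Submodule F (Ambient F n)) :=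
  {U | ∃ A ∈ A₀, 2 ≤ A.rank ∧ A.rank ≤ n - 2 ∧ liftL' A = U}

variable (F n) in
/-- The generators in the system of `S` that either are disjoint from `S'` and meet `S` in
exactly a (projective) point, or meet both `S` and `S'` non-trivially. -/
def generatorPart : Set (Submodule F (Ambient F n)) :=
  {U | IsGenerator U ∧ SameSystem U (spaceS F n) ∧
    ((U ⊓ spaceS' F n = ⊥ ∧ finrank F ↥(U ⊓ spaceS F n) = 1) ∨
      (U ⊓ spaceS F n ≠ ⊥ ∧ U ⊓ spaceS' F n ≠ ⊥))}

/-- The spaces `⟨l, m^⊥ ∩ S'⟩` for distinct lines `l`, `m` of the set `P` of lines of `S`. -/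
def extraPart (P : Set (Submodule F (Ambient F n))) : Set (Submodule F (Ambient F n)) :=
  {U | ∃ l ∈ P, ∃ m ∈ P, l ≠ m ∧ l ⊔ (perp m ⊓ spaceS' F n) = U}

/-- The code before the extra spaces are added. -/
def baseCode (A₀ : Set (Matrix (Fin n) (Fin n) F)) : Set (Submodule F (Ambient F n)) :=
  liftedPart A₀ ∪ constantRankPart A₀ ∪ generatorPart F n ∪ {spaceS F n}

end Geometry

/-! ### The size -/

/-- The Gaussian binomial coefficient, for `r ≤ n`:
`(q^n - 1) ⋯ (q^(n-r+1) - 1) / ((q^r - 1) ⋯ (q - 1))`. -/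
def gaussBinom (q n r : ℕ) : ℚ :=
  (∏ i ∈ Finset.range r, ((q : ℚ) ^ (n - i) - 1)) /
    ∏ i ∈ Finset.range r, ((q : ℚ) ^ (i + 1) - 1)

/-- For `n ≥ 5` odd, `q^(n-2) + q^(n-4) + ⋯ + q^3 + 1`. -/
def spreadSize (q n : ℕ) : ℕ :=
  1 + ∑ i ∈ Finset.Icc 1 ((n - 3) / 2), q ^ (2 * i + 1)

/-- The number of codewords (for `n ≥ 5` odd, where all divisions of exponents are exact). -/
def codeSize (q n : ℕ) : ℚ :=
  (q : ℚ) ^ (n ^ 2 - n)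
    + ∑ r ∈ Finset.Icc 2 (n - 2), gaussBinom q n r *
        ∑ j ∈ Finset.Icc 2 r, (-1 : ℚ) ^ (r - j) * gaussBinom q r j *
          (q : ℚ) ^ ((r - j).choose 2) * ((q : ℚ) ^ (n * (j - 1)) - 1)
    + ∏ i ∈ Finset.Icc 1 (n - 1), ((q : ℚ) ^ i + 1)
    - 2 * (q : ℚ) ^ (n * (n - 1) / 2)
    + (q : ℚ) ^ ((n - 1) * (n - 3) / 4)
        * ∏ i ∈ Finset.Icc 1 ((n - 1) / 2), ((q : ℚ) ^ (2 * i + 1) - 1)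
    + (spreadSize q n : ℚ) * ((spreadSize q n : ℚ) - 1)
    + 1

end SubspaceCode

open SubspaceCode

/-!
Both parts of the statement are about subspaces of `F ^ n × F ^ n`, where `S = 0 × F ^ n` and
`S' = F ^ n × 0`.

**The MRD code.** Let `b` be a basis of an extension field `E` of degree `n`. The matrices `A` with
`∑ A i j • (b i * b j) = 0` form a linear code (`mrdCode`). It contains the alternating matrices
because multiplication in `E` is commutative, and it contains no matrix of rank one because
`∑ u i * v j • (b i * b j)` is the product of `∑ u i • b i` and `∑ v j • b j`. The same map shows
that `q ^ (n * (k - 1))` of its matrices have their rows in a given subspace of dimension `k ≥ 1`.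

**Counting.** When the number of objects with support inside `W` depends only on `dim W`, Gaussian
inversion in the subspace lattice gives the number with support `W` (`card_fiber_eq`). Applied to the
row spaces of the matrices in the MRD code this is its rank distribution; applied to alternating
matrices it gives the number of them of each rank, and in particular that the rank is even.
A generator of the quadric amounts to a subspace `W` of `F ^ n`, its first projection, together with
an alternating form on `W` (`IsGenerator.exists_eq_genOf`); it lies in the system of `S` exactly when
`dim W` is even, and the dimension of its intersection with `S'` is that of the radical of the form.
So the system of `S` has `∑ [n, k] q ^ (k choose 2)` members, the sum being over even `k`, which
the `q`-binomial theorem evaluates. The generators that meet `S'` trivially are the `L'(A)` with `A`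
alternating, and those among them meeting `S` in a point have `A` of rank `n - 1`.

**Distances.** Two subspaces of dimension `n` are at distance at least `4` when they meet in dimension
at most `n - 2` (`FarApart`). For most pairs of codewords of different kinds one of the two meets `S`
or `S'` trivially and the other meets it in dimension at least `2`; two lifts `L(A)`, `L(B)`, or
`L'(A)`, `L'(B)`, meet in dimension `n - rk (A - B)`. The other cases rest on three facts:
a totally singular hyperplane of `L(A)` makes `A` the sum of an alternating matrix and one of rank at
most one, which lies in the MRD code and hence is zero (`isSkew_of_finrank_liftL_inf`); two generators
in the same system do not meet in a hyperplane (`IsGenerator.finrank_inf_add_two_le`); and the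
extra space `m ^ ⊥ × l` has no totally singular subspace of dimension `n - 1`, because
`l ∩ m = 0` (`finrank_prod_inf_le`).

**Partial line spreads.** From `F ^ n` to `F ^ (n + 2) = F ^ 2 × E` one adds the graphs of the `q ^ n`
maps `v ↦ φ v * x`, where `φ : F ^ 2 → E` is injective (`exists_isPartialLineSpread`). Conversely,
with one line more than claimed there would be `q ^ 2 - q - 1` points on no line. The number of such
points in a hyperplane is `-1` modulo `q`, hence at least `q - 1`, which exceeds the average over all
hyperplanes (`ncard_le_spreadSize`).
-/

namespace SubspaceCode

open Module

/-! ### Gaussian binomial coefficients -/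

/-- The `q`-factorial `∏_{i=1}^m (q^i - 1)`, without the usual denominators `q - 1`. -/
def qFact (q m : ℕ) : ℚ := ∏ i ∈ Finset.range m, ((q : ℚ) ^ (i + 1) - 1)

theorem pow_sub_one_ne_zero {q : ℕ} (hq : 2 ≤ q) {i : ℕ} (hi : i ≠ 0) : (q : ℚ) ^ i - 1 ≠ 0 := by
  have h : (1 : ℚ) < (q : ℚ) ^ i := one_lt_pow₀ (by exact_mod_cast hq) hi
  linarith

theorem qFact_ne_zero {q : ℕ} (hq : 2 ≤ q) (m : ℕ) : qFact q m ≠ 0 :=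
  Finset.prod_ne_zero_iff.2 fun i _ => pow_sub_one_ne_zero hq (Nat.succ_ne_zero i)

theorem qFact_succ (q m : ℕ) : qFact q (m + 1) = qFact q m * ((q : ℚ) ^ (m + 1) - 1) :=
  Finset.prod_range_succ _ _

theorem gaussBinom_zero_right (q n : ℕ) : gaussBinom q n 0 = 1 := by
  simp [gaussBinom]

theorem gaussBinom_eq_zero {q n r : ℕ} (h : n < r) : gaussBinom q n r = 0 := by
  rw [gaussBinom, Finset.prod_eq_zero (Finset.mem_range.2 h) (by simp), zero_div]

theorem gaussBinom_add {q : ℕ} (hq : 2 ≤ q) (m r : ℕ) :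
    gaussBinom q (m + r) r = qFact q (m + r) / (qFact q r * qFact q m) := by
  have h : ∏ i ∈ Finset.range r, ((q : ℚ) ^ (m + r - i) - 1)
      = ∏ i ∈ Finset.range r, ((q : ℚ) ^ (m + i + 1) - 1) := by
    rw [← Finset.prod_range_reflect]
    refine Finset.prod_congr rfl fun i hi => ?_
    rw [Finset.mem_range] at hi
    congr 2
    omega
  have h2 : qFact q (m + r) = qFact q m * ∏ i ∈ Finset.range r, ((q : ℚ) ^ (m + i + 1) - 1) :=
    Finset.prod_range_add _ _ _
  rw [gaussBinom, h, h2, ← qFact]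
  have := qFact_ne_zero hq m
  have := qFact_ne_zero hq r
  field_simp

theorem gaussBinom_self {q : ℕ} (hq : 2 ≤ q) (n : ℕ) : gaussBinom q n n = 1 := by
  have := gaussBinom_add hq 0 n
  rw [zero_add] at this
  rw [this, show qFact q 0 = 1 from Finset.prod_range_zero _, mul_one, div_self (qFact_ne_zero hq n)]

/-- The `q`-analogue of Pascal's rule. -/
theorem gaussBinom_succ_succ {q : ℕ} (hq : 2 ≤ q) {n k : ℕ} (h : k ≤ n) :
    gaussBinom q (n + 1) (k + 1)
      = gaussBinom q n (k + 1) + (q : ℚ) ^ (n - k) * gaussBinom q n k := by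
  obtain ⟨m, rfl⟩ := Nat.exists_eq_add_of_le' h
  rw [Nat.add_sub_cancel]
  rcases m with _ | m
  · rw [zero_add, gaussBinom_self hq, gaussBinom_self hq, gaussBinom_eq_zero (Nat.lt_succ_self k)]
    simp
  · have e1 : m + 1 + k = m + (k + 1) := by ring
    rw [gaussBinom_add hq (m + 1) k, add_assoc (m + 1) k 1, gaussBinom_add hq (m + 1) (k + 1), e1,
      gaussBinom_add hq m (k + 1), show m + 1 + (k + 1) = m + (k + 1) + 1 by ring,
      qFact_succ q (m + (k + 1)), qFact_succ q m, qFact_succ q k]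
    have := qFact_ne_zero hq m
    have := qFact_ne_zero hq k
    have := pow_sub_one_ne_zero hq (Nat.succ_ne_zero m)
    have := pow_sub_one_ne_zero hq (Nat.succ_ne_zero k)
    simp only [Nat.succ_eq_add_one] at *
    field_simp
    ring

/-- The trinomial revision `[k, j+s] [j+s, j] = [k, j] [k-j, s]`, with `k = j + s + t`. -/
theorem gaussBinom_mul {q : ℕ} (hq : 2 ≤ q) (t s j : ℕ) :
    gaussBinom q (t + s + j) (s + j) * gaussBinom q (s + j) j
      = gaussBinom q (t + s + j) j * gaussBinom q (t + s) s := by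
  rw [gaussBinom_add hq (t + s) j, gaussBinom_add hq t s, gaussBinom_add hq s j, add_assoc t s j,
    gaussBinom_add hq t (s + j)]
  have := qFact_ne_zero hq t
  have := qFact_ne_zero hq s
  have := qFact_ne_zero hq j
  have := qFact_ne_zero hq (s + j)
  have := qFact_ne_zero hq (t + s)
  field_simp

/-- The `q`-binomial theorem. -/
theorem prod_one_add_pow_mul {q : ℕ} (hq : 2 ≤ q) (n : ℕ) (t : ℚ) :
    ∏ i ∈ Finset.range n, (1 + (q : ℚ) ^ i * t)
      = ∑ k ∈ Finset.range (n + 1), gaussBinom q n k * (q : ℚ) ^ (k.choose 2) * t ^ k := by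
  induction n with
  | zero => simp [gaussBinom_zero_right]
  | succ n ih =>
    have h1 : ∀ k ∈ Finset.range (n + 1),
        gaussBinom q (n + 1) (k + 1) * (q : ℚ) ^ ((k + 1).choose 2) * t ^ (k + 1)
          = gaussBinom q n (k + 1) * (q : ℚ) ^ ((k + 1).choose 2) * t ^ (k + 1)
            + gaussBinom q n k * (q : ℚ) ^ (k.choose 2) * t ^ k * ((q : ℚ) ^ n * t) := by
      intro k hk
      have hk' : k ≤ n := Nat.lt_succ_iff.1 (Finset.mem_range.1 hk)
      rw [gaussBinom_succ_succ hq hk', Nat.choose_succ_succ' k 1, Nat.choose_one_right]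
      have : (q : ℚ) ^ n = (q : ℚ) ^ (n - k) * (q : ℚ) ^ k := by
        rw [← pow_add, Nat.sub_add_cancel hk']
      rw [this]
      ring
    have h2 : ∑ k ∈ Finset.range (n + 1),
          gaussBinom q n (k + 1) * (q : ℚ) ^ ((k + 1).choose 2) * t ^ (k + 1) + 1
        = ∑ k ∈ Finset.range (n + 1), gaussBinom q n k * (q : ℚ) ^ (k.choose 2) * t ^ k := by
      rw [Finset.sum_range_succ, gaussBinom_eq_zero (Nat.lt_succ_self n), zero_mul, zero_mul,
        add_zero, Finset.sum_range_succ' _ n, gaussBinom_zero_right]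
      simp
    rw [Finset.prod_range_succ, ih, Finset.sum_range_succ' _ (n + 1), Finset.sum_congr rfl h1,
      Finset.sum_add_distrib, gaussBinom_zero_right, ← Finset.sum_mul]
    have : (1 : ℚ) * (q : ℚ) ^ (Nat.choose 0 2) * t ^ 0 = 1 := by simp
    rw [this]
    linear_combination -h2

theorem sum_neg_one_pow_gaussBinom {q : ℕ} (hq : 2 ≤ q) (m : ℕ) :
    ∑ s ∈ Finset.range (m + 1), gaussBinom q m s * (q : ℚ) ^ (s.choose 2) * (-1) ^ s
      = if m = 0 then 1 else 0 := by
  rw [← prod_one_add_pow_mul hq m (-1)]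
  split_ifs with h
  · simp [h]
  · exact Finset.prod_eq_zero (Finset.mem_range.2 (Nat.pos_of_ne_zero h)) (by simp)

/-- Gaussian inversion. -/
theorem sum_gaussBinom_inversion {q : ℕ} (hq : 2 ≤ q) (h : ℕ → ℚ) (k : ℕ) :
    ∑ r ∈ Finset.range (k + 1), gaussBinom q k r *
      ∑ j ∈ Finset.range (r + 1),
        (-1 : ℚ) ^ (r - j) * gaussBinom q r j * (q : ℚ) ^ ((r - j).choose 2) * h j = h k := by
  simp_rw [Finset.mul_sum]
  rw [Finset.sum_comm' (t' := Finset.range (k + 1)) (s' := fun j => Finset.Ico j (k + 1))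
    (by intro x y; simp only [Finset.mem_range, Finset.mem_Ico]; omega)]
  have key : ∀ j ∈ Finset.range (k + 1),
      ∑ r ∈ Finset.Ico j (k + 1), gaussBinom q k r * ((-1 : ℚ) ^ (r - j) * gaussBinom q r j *
        (q : ℚ) ^ ((r - j).choose 2) * h j) = if j = k then h k else 0 := by
    intro j hj
    obtain ⟨m, rfl⟩ := Nat.exists_eq_add_of_le' (Nat.lt_succ_iff.1 (Finset.mem_range.1 hj))
    rw [Finset.sum_Ico_eq_sum_range, show m + j + 1 - j = m + 1 by omega]
    have : ∀ s ∈ Finset.range (m + 1), gaussBinom q (m + j) (j + s) *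
        ((-1 : ℚ) ^ (j + s - j) * gaussBinom q (j + s) j *
        (q : ℚ) ^ ((j + s - j).choose 2) * h j)
        = (gaussBinom q m s * (q : ℚ) ^ (s.choose 2) * (-1) ^ s) *
          (gaussBinom q (m + j) j * h j) := by
      intro s hs
      obtain ⟨t, rfl⟩ := Nat.exists_eq_add_of_le' (Nat.lt_succ_iff.1 (Finset.mem_range.1 hs))
      have := gaussBinom_mul hq t s j
      rw [Nat.add_sub_cancel_left, add_comm j s]
      linear_combination ((-1 : ℚ) ^ s * (q : ℚ) ^ (s.choose 2) * h j) * this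
    rw [Finset.sum_congr rfl this, ← Finset.sum_mul, sum_neg_one_pow_gaussBinom hq]
    by_cases hm : m = 0
    · subst hm
      simp [gaussBinom_self hq]
    · simp [hm]
  rw [Finset.sum_congr rfl key]
  simp

theorem sum_even_gaussBinom {q : ℕ} (hq : 2 ≤ q) {n : ℕ} (hn : 1 ≤ n) :
    ∑ k ∈ Finset.range (n + 1) with Even k, gaussBinom q n k * (q : ℚ) ^ (k.choose 2)
      = ∏ i ∈ Finset.Icc 1 (n - 1), ((q : ℚ) ^ i + 1) := by
  -- Average the `q`-binomial theorem at `t = 1` and `t = -1`.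
  have h1 := prod_one_add_pow_mul hq n 1
  have h2 := sum_neg_one_pow_gaussBinom hq n
  rw [if_neg (by omega)] at h2
  obtain ⟨m, rfl⟩ := Nat.exists_eq_add_of_le' hn
  have h3 : ∏ i ∈ Finset.Icc 1 (m + 1 - 1), ((q : ℚ) ^ i + 1)
      = ∏ i ∈ Finset.range m, (1 + (q : ℚ) ^ (i + 1) * 1) := by
    rw [Nat.add_sub_cancel, Finset.range_eq_Ico, Finset.prod_Ico_add'
      (fun i => (1 + (q : ℚ) ^ i * 1)) 0 m 1]
    exact Finset.prod_congr rfl fun i _ => by ring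
  rw [Finset.prod_range_succ'] at h1
  rw [h3, Finset.sum_filter]
  have h4 : ∀ k ∈ Finset.range (m + 1 + 1),
      (if Even k then gaussBinom q (m + 1) k * (q : ℚ) ^ (k.choose 2) else 0)
      = (gaussBinom q (m + 1) k * (q : ℚ) ^ (k.choose 2) * 1 ^ k
        + gaussBinom q (m + 1) k * (q : ℚ) ^ (k.choose 2) * (-1) ^ k) / 2 := by
    intro k _
    rcases Nat.even_or_odd k with h | h
    · simp [h]
    · simp [Nat.not_even_iff_odd.2 h, h.neg_one_pow]
  rw [Finset.sum_congr rfl h4, ← Finset.sum_div, Finset.sum_add_distrib, h2, ← h1]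
  ring

/-- The closed form `q ^ (m (m - 1)) ∏_{i < m} (q ^ (2 i + 1) - 1)`, for `s = 2 m`, and zero for odd
`s`, of the number of nondegenerate alternating forms on an `s`-dimensional space over the field
with `q` elements. -/
def nondegAltCount (q s : ℕ) : ℚ :=
  if Even s then (q : ℚ) ^ (s / 2 * (s / 2 - 1)) *
    ∏ i ∈ Finset.range (s / 2), ((q : ℚ) ^ (2 * i + 1) - 1) else 0

/-- Classifying the alternating forms on an `n`-dimensional space by their radicals. -/
theorem sum_gaussBinom_nondegAltCount {q : ℕ} (hq : 2 ≤ q) (n : ℕ) :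
    ∑ s ∈ Finset.range (n + 1), gaussBinom q n s * nondegAltCount q s
      = (q : ℚ) ^ (n.choose 2) := by
  -- `R n m` is the number of alternating `n × n` matrices of rank `2 m`; the recursion in `n`
  -- is the one given by bordering a matrix.
  set c : ℕ → ℚ := fun m => (q : ℚ) ^ (m * (m - 1)) *
    ∏ i ∈ Finset.range m, ((q : ℚ) ^ (2 * i + 1) - 1) with hc
  set R : ℕ → ℕ → ℚ := fun n m => gaussBinom q n (2 * m) * c m with hR
  have hcs : ∀ m, c (m + 1) = c m * ((q : ℚ) ^ (2 * m) * ((q : ℚ) ^ (2 * m + 1) - 1)) := by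
    intro m
    simp only [hc]
    rw [Finset.prod_range_succ, show (m + 1) * (m + 1 - 1) = m * (m - 1) + 2 * m by
      rcases m with _ | m
      · rfl
      · simp only [Nat.add_sub_cancel]; ring]
    ring
  have hrec : ∀ n m, R (n + 1) (m + 1)
      = (q : ℚ) ^ (2 * m + 2) * R n (m + 1) + ((q : ℚ) ^ n - (q : ℚ) ^ (2 * m)) * R n m := by
    intro n m
    simp only [hR, hcs]
    rcases lt_trichotomy n (2 * m) with h | rfl | h
    · rw [gaussBinom_eq_zero (show n + 1 < 2 * (m + 1) by omega),
        gaussBinom_eq_zero (show n < 2 * (m + 1) by omega), gaussBinom_eq_zero h]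
      ring
    · rw [gaussBinom_eq_zero (show 2 * m + 1 < 2 * (m + 1) by omega),
        gaussBinom_eq_zero (show 2 * m < 2 * (m + 1) by omega)]
      ring
    · obtain ⟨d, rfl⟩ := Nat.exists_eq_add_of_le' h
      have hq0 : (q : ℚ) ≠ 0 := by positivity
      have n1 := qFact_ne_zero hq d
      have n2 := qFact_ne_zero hq (2 * m)
      have n3 := pow_sub_one_ne_zero hq (show 2 * m + 1 ≠ 0 by omega)
      have n4 := pow_sub_one_ne_zero hq (show 2 * m + 1 + 1 ≠ 0 by omega)
      have n5 := pow_sub_one_ne_zero hq (show d + 1 ≠ 0 by omega)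
      have n6 := qFact_ne_zero hq (d + (2 * m).succ)
      have e1 := gaussBinom_add hq (d + 1) (2 * m)
      have e2 := gaussBinom_add hq d (2 * m + 1 + 1)
      rw [show d + 1 + 2 * m = d + (2 * m).succ by omega] at e1
      rw [show d + (2 * m + 1 + 1) = d + (2 * m).succ + 1 by omega] at e2
      rw [show 2 * (m + 1) = 2 * m + 1 + 1 by ring, e1, e2]
      have e3 : gaussBinom q (d + (2 * m).succ) (2 * m + 1 + 1)
          = gaussBinom q (d + (2 * m).succ) (2 * m) *
            (((q : ℚ) ^ (d + 1) - 1) * ((q : ℚ) ^ d - 1) /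
              (((q : ℚ) ^ (2 * m + 1) - 1) * ((q : ℚ) ^ (2 * m + 1 + 1) - 1))) := by
        rw [gaussBinom, gaussBinom, Finset.prod_range_succ, Finset.prod_range_succ,
          Finset.prod_range_succ _ (2 * m + 1), Finset.prod_range_succ _ (2 * m),
          show d + (2 * m).succ - 2 * m = d + 1 by omega,
          show d + (2 * m).succ - (2 * m + 1) = d by omega]
        rw [← qFact]
        field_simp
      rw [e3, e1]
      simp only [qFact_succ]
      field_simp
      simp only [Nat.succ_eq_add_one]
      ring
  have h0 : ∀ n, R n 0 = 1 := fun n => by simp [hR, hc, gaussBinom_zero_right]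
  have tot : ∀ n, ∑ m ∈ Finset.range (n + 1), R n m = (q : ℚ) ^ (n.choose 2) := by
    intro n
    induction n with
    | zero => simp [h0]
    | succ n ih =>
      have hlast : R n (n + 1) = 0 := by
        simp only [hR]; rw [gaussBinom_eq_zero (by omega), zero_mul]
      -- In the recursion, `q ^ (2 m + 2) * R n (m + 1) - q ^ (2 m) * R n m` telescopes.
      have htel := Finset.sum_range_sub (fun m => (q : ℚ) ^ (2 * m) * R n m) (n + 1)
      have hsum : ∑ m ∈ Finset.range (n + 1), R (n + 1) (m + 1)
          = ∑ m ∈ Finset.range (n + 1),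
              ((q : ℚ) ^ (2 * (m + 1)) * R n (m + 1) - (q : ℚ) ^ (2 * m) * R n m)
            + (q : ℚ) ^ n * ∑ m ∈ Finset.range (n + 1), R n m := by
        rw [Finset.mul_sum, ← Finset.sum_add_distrib]
        refine Finset.sum_congr rfl fun m _ => ?_
        rw [hrec]; ring
      rw [Finset.sum_range_succ', hsum, htel, ih, h0, h0, hlast, Nat.choose_succ_succ' n 1,
        Nat.choose_one_right, pow_add]
      simp
  rw [← tot n]
  -- Only the even `s` contribute.
  have hev : ∑ s ∈ Finset.range (n + 1), gaussBinom q n s * nondegAltCount q s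
      = ∑ s ∈ (Finset.range (n + 1)).filter Even, gaussBinom q n s * nondegAltCount q s := by
    rw [Finset.sum_filter]
    refine Finset.sum_congr rfl fun s _ => ?_
    split_ifs with h
    · rfl
    · simp [nondegAltCount, h]
  rw [hev, eq_comm]
  refine Finset.sum_bij_ne_zero (fun m _ _ => 2 * m) ?_ ?_ ?_ ?_
  · intro m _ h
    simp only [Finset.mem_filter, Finset.mem_range, even_two, Even.mul_right, and_true]
    by_contra hcon
    exact h (by simp only [hR]; rw [gaussBinom_eq_zero (by omega), zero_mul])
  · intro a _ _ b _ _ h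
    omega
  · intro s hs h
    simp only [Finset.mem_filter, Finset.mem_range] at hs
    obtain ⟨m, hm⟩ := hs.2
    have e : s = 2 * m := by omega
    subst e
    refine ⟨m, by simp; omega, ?_, rfl⟩
    simpa [nondegAltCount, hR, hc] using h
  · intro m _ _
    simp [nondegAltCount, hR, hc]

/-- The number of alternating `n × n` matrices of corank one, for `n` odd. -/
theorem gaussBinom_mul_nondegAltCount_pred {q : ℕ} (hq : 2 ≤ q) {n : ℕ} (hodd : Odd n) :
    gaussBinom q n (n - 1) * nondegAltCount q (n - 1)
      = (q : ℚ) ^ ((n - 1) * (n - 3) / 4)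
        * ∏ i ∈ Finset.Icc 1 ((n - 1) / 2), ((q : ℚ) ^ (2 * i + 1) - 1) := by
  obtain ⟨m, rfl⟩ := hodd
  have e1 : 2 * m + 1 - 1 = 2 * m := by omega
  have e2 : 2 * m / 2 = m := by omega
  have e3 : 2 * m * (2 * m + 1 - 3) / 4 = m * (m - 1) := by
    rcases m with _ | m
    · rfl
    · rw [show 2 * (m + 1) * (2 * (m + 1) + 1 - 3) = 4 * ((m + 1) * (m + 1 - 1)) by
        rw [show 2 * (m + 1) + 1 - 3 = 2 * m by omega, Nat.add_sub_cancel]; ring]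
      omega
  have e4 : ∏ i ∈ Finset.Icc 1 m, ((q : ℚ) ^ (2 * i + 1) - 1)
      = ∏ i ∈ Finset.range m, ((q : ℚ) ^ (2 * (i + 1) + 1) - 1) := by
    rw [Finset.range_eq_Ico, Finset.prod_Ico_add' (fun i => ((q : ℚ) ^ (2 * i + 1) - 1)) 0 m 1]
    rfl
  have e5 := Finset.prod_range_succ' (fun i => ((q : ℚ) ^ (2 * i + 1) - 1)) m
  rw [Finset.prod_range_succ] at e5
  have e6 := gaussBinom_add hq 1 (2 * m)
  rw [show qFact q 1 = (q : ℚ) - 1 by simp [qFact], add_comm 1 (2 * m), qFact_succ] at e6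
  have n1 := qFact_ne_zero hq (2 * m)
  have n2 := pow_sub_one_ne_zero hq one_ne_zero
  rw [pow_one] at n2
  rw [e1, e2, e3, e4, e6, nondegAltCount, if_pos (even_two_mul m), e2]
  field_simp
  simp only [mul_zero, zero_add, pow_one] at e5
  linear_combination e5

/-! ### Counting subspaces, and Gaussian inversion in the subspace lattice -/

section SubspaceCount

variable {F V : Type*} [Field F] [Finite F] [AddCommGroup V] [Module F V] [FiniteDimensional F V]

theorem finite_of_finiteDimensional (F V : Type*) [Field F] [Finite F] [AddCommGroup V]
    [Module F V] [FiniteDimensional F V] : Finite V :=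
  Module.finite_of_finite F

theorem finite_submodule (F V : Type*) [Field F] [Finite F] [AddCommGroup V]
    [Module F V] [FiniteDimensional F V] : Finite (Submodule F V) :=
  haveI := finite_of_finiteDimensional F V
  Finite.of_injective _ (SetLike.coe_injective (A := Submodule F V))

theorem card_linearIndependent_eq_mul (k : ℕ) :
    Nat.card {s : Fin k → V // LinearIndependent F s}
      = Nat.card {W : Submodule F V // finrank F W = k}
        * Nat.card {s : Fin k → (Fin k → F) // LinearIndependent F s} := by
  have := finite_submodule F V
  -- A linearly independent `k`-tuple is a `k`-dimensional subspace together with a basis of it.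
  let f : (Σ W : {W : Submodule F V // finrank F W = k},
      {s : Fin k → W.1 // LinearIndependent F s}) → {s : Fin k → V // LinearIndependent F s} :=
    fun x => ⟨fun i => (x.2.1 i : V), x.2.2.map' x.1.1.subtype (Submodule.ker_subtype _)⟩
  have hspan : ∀ (W : {W : Submodule F V // finrank F W = k})
      (s : {s : Fin k → W.1 // LinearIndependent F s}),
      Submodule.span F (Set.range fun i => (s.1 i : V)) = W.1 := by
    intro W s
    refine Submodule.eq_of_le_of_finrank_eq ?_ ?_
    · rw [Submodule.span_le]
      rintro _ ⟨i, rfl⟩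
      exact (s.1 i).2
    · have hs := s.2.map' W.1.subtype (Submodule.ker_subtype _)
      have := finrank_span_eq_card hs
      rw [W.2]
      simpa only [Fintype.card_fin] using! this
  have hf : Function.Bijective f := by
    constructor
    · rintro ⟨⟨W, hW⟩, s⟩ ⟨⟨W', hW'⟩, s'⟩ h
      have h' : (fun i => (s.1 i : V)) = fun i => (s'.1 i : V) := congrArg Subtype.val h
      have e : W = W' := by
        have h1 := hspan ⟨W, hW⟩ s
        have h2 := hspan ⟨W', hW'⟩ s'
        simp only at h1 h2
        rw [← h1, ← h2, h']
      subst e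
      congr 1
      ext i
      exact congrFun h' i
    · rintro ⟨s, hs⟩
      refine ⟨⟨⟨Submodule.span F (Set.range s), by simpa using finrank_span_eq_card hs⟩,
        ⟨fun i => ⟨s i, Submodule.subset_span ⟨i, rfl⟩⟩, ?_⟩⟩, rfl⟩
      exact linearIndependent_span hs
  have := finite_of_finiteDimensional F V
  have e : ∀ W : {W : Submodule F V // finrank F W = k},
      Nat.card {s : Fin k → W.1 // LinearIndependent F s}
        = Nat.card {s : Fin k → (Fin k → F) // LinearIndependent F s} := by
    intro W
    let φ : W.1 ≃ₗ[F] (Fin k → F) := LinearEquiv.ofFinrankEq _ _ (by rw [W.2]; simp)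
    refine Nat.card_congr ((Equiv.arrowCongr (Equiv.refl _) φ.toEquiv).subtypeEquiv fun s => ?_)
    exact (LinearMap.linearIndependent_iff (v := s) φ.toLinearMap φ.ker).symm
  have := Fintype.ofFinite {W : Submodule F V // finrank F W = k}
  rw [← Nat.card_congr (Equiv.ofBijective f hf), Nat.card_sigma, Finset.sum_congr rfl fun W _ => e W,
    Finset.sum_const, smul_eq_mul, Finset.card_univ,
    Nat.card_eq_fintype_card (α := {W : Submodule F V // finrank F W = k})]

/-- The Gaussian binomial coefficient counts the subspaces of a given dimension. -/
theorem card_subspaces (k : ℕ) :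
    (Nat.card {W : Submodule F V // finrank F W = k} : ℚ)
      = gaussBinom (Nat.card F) (finrank F V) k := by
  rcases lt_or_ge (finrank F V) k with h | h
  · rw [gaussBinom_eq_zero h]
    have : IsEmpty {W : Submodule F V // finrank F W = k} :=
      ⟨fun W => absurd (Submodule.finrank_le W.1) (by rw [W.2]; omega)⟩
    simp
  have := finite_of_finiteDimensional F V
  have := Fintype.ofFinite F
  have hq : 2 ≤ Nat.card F := Finite.one_lt_card
  have h1 := card_linearIndependent_eq_mul (F := F) (V := V) k
  rw [card_linearIndependent h, card_linearIndependent (by simp)] at h1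
  simp only [← Nat.card_eq_fintype_card, finrank_fin_fun] at h1
  set q := Nat.card F
  have hprod : ∀ m, k ≤ m → ((∏ i : Fin k, (q ^ m - q ^ (i : ℕ)) : ℕ) : ℚ)
      = (∏ i ∈ Finset.range k, (q : ℚ) ^ i) * ∏ i ∈ Finset.range k, ((q : ℚ) ^ (m - i) - 1) := by
    intro m hm
    rw [Fin.prod_univ_eq_prod_range (fun i => q ^ m - q ^ i) k, Nat.cast_prod,
      ← Finset.prod_mul_distrib]
    refine Finset.prod_congr rfl fun i hi => ?_
    have hi' : i ≤ m := (Finset.mem_range.1 hi).le.trans hm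
    rw [Nat.cast_sub (Nat.pow_le_pow_right (by omega) hi'), mul_sub, ← pow_add,
      Nat.add_sub_cancel' hi']
    push_cast
    ring
  have h2 := congrArg (Nat.cast (R := ℚ)) h1
  rw [Nat.cast_mul, hprod _ h, hprod k le_rfl] at h2
  have n1 : ∏ i ∈ Finset.range k, (q : ℚ) ^ i ≠ 0 :=
    Finset.prod_ne_zero_iff.2 fun i _ => by positivity
  have n2 : ∏ i ∈ Finset.range k, ((q : ℚ) ^ (k - i) - 1) ≠ 0 :=
    Finset.prod_ne_zero_iff.2 fun i hi => pow_sub_one_ne_zero hq (by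
      have := Finset.mem_range.1 hi; omega)
  have h3 : gaussBinom q k k = 1 := gaussBinom_self hq k
  rw [gaussBinom, div_eq_one_iff_eq (Finset.prod_ne_zero_iff.2 fun i _ =>
    pow_sub_one_ne_zero hq (Nat.succ_ne_zero i))] at h3
  rw [gaussBinom, ← h3, eq_div_iff n2]
  apply mul_left_cancel₀ n1
  rw [h2]
  ring

theorem card_subspaces_le (W : Submodule F V) (k : ℕ) :
    (Nat.card {U : Submodule F V // U ≤ W ∧ finrank F U = k} : ℚ)
      = gaussBinom (Nat.card F) (finrank F W) k := by
  rw [← card_subspaces]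
  congr 1
  symm
  refine Nat.card_congr (((Submodule.mapIic W).toEquiv.subtypeEquiv fun U => ?_).trans
    (Equiv.subtypeSubtypeEquivSubtypeInter (fun U => U ≤ W) fun U => finrank F U = k))
  have : finrank F ↥((Submodule.mapIic W U : Submodule F V)) = finrank F U :=
    Submodule.finrank_map_subtype_eq W U
  exact ⟨fun h => this.trans h, fun h => this.symm.trans h⟩

open Classical in
theorem sum_subspaces_le [Fintype (Submodule F V)] (W : Submodule F V) (g : ℕ → ℚ) :
    ∑ U : Submodule F V with U ≤ W, g (finrank F U)
      = ∑ j ∈ Finset.range (finrank F W + 1), gaussBinom (Nat.card F) (finrank F W) j * g j := by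
  rw [← Finset.sum_fiberwise_of_maps_to (g := fun U : Submodule F V => finrank F U)
    (t := Finset.range (finrank F W + 1))]
  · refine Finset.sum_congr rfl fun j _ => ?_
    rw [← card_subspaces_le, Nat.card_eq_fintype_card, Fintype.card_subtype, Finset.filter_filter,
      ← nsmul_eq_mul, ← Finset.sum_const]
    refine Finset.sum_congr rfl fun U hU => ?_
    rw [(Finset.mem_filter.1 hU).2.2]
  · intro U hU
    rw [Finset.mem_range, Nat.lt_succ_iff]
    exact Submodule.finrank_mono (Finset.mem_filter.1 hU).2

variable {α : Type*} [Finite α]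

/-- Let `ρ` assign a subspace to each object of a finite family, so that the number of objects
with `ρ a ≤ W` depends on `dim W` only. Then so does the number of objects with `ρ a = W`, and it
is determined by Gaussian inversion. -/
theorem card_fiber_eq (ρ : α → Submodule F V) (B g : ℕ → ℚ)
    (hB : ∀ W, (Nat.card {a // ρ a ≤ W} : ℚ) = B (finrank F W))
    (hg : ∀ k ≤ finrank F V,
      ∑ j ∈ Finset.range (k + 1), gaussBinom (Nat.card F) k j * g j = B k)
    (W : Submodule F V) : (Nat.card {a // ρ a = W} : ℚ) = g (finrank F W) := by
  classical
  have := finite_submodule F V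
  have := Fintype.ofFinite (Submodule F V)
  have := Fintype.ofFinite α
  induction hk : finrank F W using Nat.strong_induction_on generalizing W with
  | _ k ih =>
    subst hk
    have h1 : (Nat.card {a // ρ a ≤ W} : ℚ)
        = ∑ U : Submodule F V with U ≤ W, (Nat.card {a // ρ a = U} : ℚ) := by
      rw [Nat.card_eq_fintype_card, Fintype.card_subtype, Finset.card_eq_sum_card_fiberwise
        (f := ρ) (t := Finset.univ.filter (· ≤ W)) (fun a ha => by simpa using ha)]
      push_cast
      refine Finset.sum_congr rfl fun U hU => ?_
      rw [Nat.card_eq_fintype_card, Fintype.card_subtype, Finset.filter_filter]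
      congr 2
      ext a
      simp only [Finset.mem_filter, Finset.mem_univ, true_and, and_iff_right_iff_imp]
      rintro rfl
      exact (Finset.mem_filter.1 hU).2
    rw [hB, ← hg _ (Submodule.finrank_le W), ← sum_subspaces_le] at h1
    have hmem : W ∈ Finset.univ.filter (· ≤ W) := by simp
    rw [← Finset.add_sum_erase _ _ hmem, ← Finset.add_sum_erase _ _ hmem] at h1
    have h2 : ∀ U ∈ (Finset.univ.filter (· ≤ W)).erase W,
        (Nat.card {a // ρ a = U} : ℚ) = g (finrank F U) := by
      intro U hU
      have hU' := Finset.mem_erase.1 hU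
      have hlt : U < W := lt_of_le_of_ne (Finset.mem_filter.1 hU'.2).2 hU'.1
      exact ih _ (Submodule.finrank_lt_finrank_of_lt hlt) U rfl
    rw [Finset.sum_congr rfl h2] at h1
    exact (add_right_cancel h1).symm

/-- The number of objects with a given dimension of `ρ a`, under the hypotheses of
`card_fiber_eq`. -/
theorem card_finrank_eq (ρ : α → Submodule F V) (B g : ℕ → ℚ)
    (hB : ∀ W, (Nat.card {a // ρ a ≤ W} : ℚ) = B (finrank F W))
    (hg : ∀ k ≤ finrank F V,
      ∑ j ∈ Finset.range (k + 1), gaussBinom (Nat.card F) k j * g j = B k)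
    (r : ℕ) : (Nat.card {a // finrank F (ρ a) = r} : ℚ)
      = gaussBinom (Nat.card F) (finrank F V) r * g r := by
  classical
  have := finite_submodule F V
  have := Fintype.ofFinite (Submodule F V)
  have := Fintype.ofFinite α
  rw [Nat.card_eq_fintype_card, Fintype.card_subtype, Finset.card_eq_sum_card_fiberwise
    (f := ρ) (t := Finset.univ.filter fun U => finrank F U = r) (fun a ha => by simpa using ha),
    ← card_subspaces, Nat.card_eq_fintype_card, Fintype.card_subtype, ← nsmul_eq_mul,
    ← Finset.sum_const]
  push_cast
  refine Finset.sum_congr rfl fun U hU => ?_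
  have hU' := (Finset.mem_filter.1 hU).2
  rw [← hU', ← card_fiber_eq ρ B g hB hg U, Nat.card_eq_fintype_card, Fintype.card_subtype,
    Finset.filter_filter, hU']
  congr 2
  ext a
  simp only [Finset.mem_filter, Finset.mem_univ, true_and, and_iff_right_iff_imp]
  rintro rfl
  exact hU'

end SubspaceCount

/-! ### Row spaces -/

section RowSpace

open Matrix

variable {F : Type*} [Field F]

/-- The row space of a matrix. -/
def rowSpace {m n : ℕ} (A : Matrix (Fin m) (Fin n) F) : Submodule F (Fin n → F) :=
  Submodule.span F (Set.range A.row)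

theorem finrank_rowSpace {m n : ℕ} (A : Matrix (Fin m) (Fin n) F) :
    finrank F (rowSpace A) = A.rank :=
  (Matrix.rank_eq_finrank_span_row A).symm

theorem rowSpace_le_iff {m n : ℕ} {A : Matrix (Fin m) (Fin n) F} {W : Submodule F (Fin n → F)} :
    rowSpace A ≤ W ↔ ∀ i, A i ∈ W := by
  rw [rowSpace, Submodule.span_le, Set.range_subset_iff]
  rfl

/-- A subspace is the row space of a matrix `P` that has a right inverse `Q`. -/
theorem exists_rowBasis {n : ℕ} (W : Submodule F (Fin n → F)) :
    ∃ (P : Matrix (Fin (finrank F W)) (Fin n) F) (Q : Matrix (Fin n) (Fin (finrank F W)) F),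
      P * Q = 1 ∧ ∀ x, x ∈ W ↔ ∃ c, c ᵥ* P = x := by
  let e : (Fin (finrank F W) → F) ≃ₗ[F] W := LinearEquiv.ofFinrankEq _ _ (by simp)
  let f : (Fin (finrank F W) → F) →ₗ[F] (Fin n → F) := W.subtype ∘ₗ e.toLinearMap
  have hf : LinearMap.ker f = ⊥ := by
    rw [LinearMap.ker_eq_bot]
    exact W.injective_subtype.comp e.injective
  obtain ⟨g, hg⟩ := f.exists_leftInverse_of_injective hf
  refine ⟨(LinearMap.toMatrix' f)ᵀ, (LinearMap.toMatrix' g)ᵀ, ?_, fun x => ?_⟩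
  · rw [← Matrix.transpose_mul, ← LinearMap.toMatrix'_comp, hg, LinearMap.toMatrix'_id,
      Matrix.transpose_one]
  · simp only [Matrix.vecMul_transpose, LinearMap.toMatrix'_mulVec]
    constructor
    · intro hx
      exact ⟨e.symm ⟨x, hx⟩, by simp [f]⟩
    · rintro ⟨c, rfl⟩
      exact (e c).2

theorem rowSpace_le_iff_mul_mul_eq {m n k : ℕ} {W : Submodule F (Fin n → F)}
    {P : Matrix (Fin k) (Fin n) F} {Q : Matrix (Fin n) (Fin k) F} (hPQ : P * Q = 1)
    (hW : ∀ x, x ∈ W ↔ ∃ c, c ᵥ* P = x) {A : Matrix (Fin m) (Fin n) F} :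
    rowSpace A ≤ W ↔ A * Q * P = A := by
  rw [rowSpace_le_iff]
  constructor
  · intro h
    funext i
    obtain ⟨c, hc⟩ := (hW _).1 (h i)
    rw [Matrix.mul_apply_eq_vecMul, Matrix.mul_apply_eq_vecMul, ← hc,
      Matrix.vecMul_vecMul c P Q, hPQ, Matrix.vecMul_one]
  · intro h i
    exact (hW _).2 ⟨(A * Q) i, by rw [← Matrix.mul_apply_eq_vecMul, h]⟩

end RowSpace

/-! ### Alternating matrices -/

section Alternating

open Matrix

variable {F : Type*} [Field F]

theorem isSkew_iff {n : ℕ} {A : Matrix (Fin n) (Fin n) F} :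
    IsSkew A ↔ (∀ i j, A j i = -A i j) ∧ ∀ i, A i i = 0 :=
  and_congr_left' ⟨fun h i j => congrFun (congrFun h i) j, fun h => by ext i j; exact h i j⟩

theorem IsSkew.sub {n : ℕ} {A B : Matrix (Fin n) (Fin n) F} (hA : IsSkew A) (hB : IsSkew B) :
    IsSkew (A - B) := by
  rw [isSkew_iff] at *
  refine ⟨fun i j => ?_, fun i => ?_⟩
  · rw [Matrix.sub_apply, Matrix.sub_apply, hA.1 i j, hB.1 i j]; ring
  · rw [Matrix.sub_apply, hA.2, hB.2, sub_zero]

theorem IsSkew.dotProduct_mulVec_self {n : ℕ} {A : Matrix (Fin n) (Fin n) F} (hA : IsSkew A)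
    (x : Fin n → F) : x ⬝ᵥ A *ᵥ x = 0 := by
  rw [isSkew_iff] at hA
  have h : x ⬝ᵥ A *ᵥ x = ∑ p : Fin n × Fin n, x p.1 * (A p.1 p.2 * x p.2) := by
    rw [Fintype.sum_prod_type]
    simp [dotProduct, mulVec, Finset.mul_sum]
  rw [h]
  refine Finset.sum_involution (fun p _ => p.swap) ?_ ?_ (by simp) (by simp)
  · intro p _
    simp only [Prod.fst_swap, Prod.snd_swap]
    rw [hA.1 p.1 p.2]
    ring
  · rintro ⟨i, j⟩ _ hne heq
    simp only [Prod.swap_prod_mk, Prod.mk.injEq] at heq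
    obtain ⟨rfl, -⟩ := heq
    simp [hA.2] at hne

/-- The alternating matrices are those of the quadratic form zero. -/
theorem isSkew_iff_forall {n : ℕ} {A : Matrix (Fin n) (Fin n) F} :
    IsSkew A ↔ ∀ x, x ⬝ᵥ A *ᵥ x = 0 := by
  refine ⟨fun h => h.dotProduct_mulVec_self, fun h => ?_⟩
  have hd : ∀ i, A i i = 0 := fun i => by simpa using h (Pi.single i 1)
  refine isSkew_iff.2 ⟨fun i j => ?_, hd⟩
  have := h (Pi.single i 1 + Pi.single j 1)
  simp only [mulVec_add, dotProduct_add, add_dotProduct, mulVec_single_one,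
    single_one_dotProduct, col_apply, hd, zero_add, add_zero] at this
  linear_combination this

/-- Congruence preserves alternating matrices. -/
theorem IsSkew.congr {n k : ℕ} {A : Matrix (Fin k) (Fin k) F} (hA : IsSkew A)
    (P : Matrix (Fin k) (Fin n) F) : IsSkew (Pᵀ * A * P) := by
  rw [isSkew_iff_forall] at *
  intro x
  rw [← Matrix.mulVec_mulVec, ← Matrix.mulVec_mulVec, Matrix.dotProduct_mulVec,
    Matrix.vecMul_transpose]
  exact hA _

theorem card_isSkew [Finite F] (k : ℕ) :
    Nat.card {A : Matrix (Fin k) (Fin k) F // IsSkew A} = Nat.card F ^ (k.choose 2) := by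
  -- The entries below the diagonal are arbitrary and determine the matrix.
  let f : {A : Matrix (Fin k) (Fin k) F // IsSkew A} → ∀ i : Fin k, (Fin i → F) :=
    fun A i j => A.1 i ⟨j, j.2.trans i.2⟩
  have hf : Function.Bijective f := by
    constructor
    · rintro ⟨A, hA⟩ ⟨B, hB⟩ h
      have hlt : ∀ i j : Fin k, j < i → A i j = B i j := fun i j hij =>
        congrFun (congrFun h i) ⟨j, hij⟩
      rw [isSkew_iff] at hA hB
      refine Subtype.ext (Matrix.ext fun i j => ?_)
      change A i j = B i j
      rcases lt_trichotomy i j with hij | rfl | hij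
      · rw [hA.1 j i, hB.1 j i, hlt j i hij]
      · rw [hA.2, hB.2]
      · exact hlt i j hij
    · intro g
      refine ⟨⟨fun i j => if h : j < i then g i ⟨j, h⟩ else if h : i < j then -g j ⟨i, h⟩ else 0,
        isSkew_iff.2 ⟨fun i j => ?_, fun i => by simp⟩⟩, ?_⟩
      · rcases lt_trichotomy i j with hij | rfl | hij
        · simp [hij, hij.not_gt]
        · simp
        · simp [hij, hij.not_gt]
      · funext i j
        have : (⟨j, j.2.trans i.2⟩ : Fin k) < i := j.2
        simp [f, this]
  rw [Nat.card_congr (Equiv.ofBijective f hf), Nat.card_pi]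
  simp only [Nat.card_fun, Nat.card_fin]
  rw [Fin.prod_univ_eq_prod_range (fun i => Nat.card F ^ i) k, Finset.prod_pow_eq_pow_sum,
    Finset.sum_range_id, Nat.choose_two_right]

/-- Alternating matrices with rows in `W` are the products `Pᵀ * B * P`, with the rows of `P` a basis
of `W` and `B` alternating. -/
theorem card_isSkew_rowSpace_le [Finite F] {n : ℕ} (W : Submodule F (Fin n → F)) :
    Nat.card {A : {A : Matrix (Fin n) (Fin n) F // IsSkew A} // rowSpace A.1 ≤ W}
      = Nat.card F ^ ((finrank F W).choose 2) := by
  obtain ⟨P, Q, hPQ, hW⟩ := exists_rowBasis W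
  rw [← card_isSkew]
  symm
  have key : ∀ A : {A : {A : Matrix (Fin n) (Fin n) F // IsSkew A} // rowSpace A.1 ≤ W},
      Pᵀ * (Qᵀ * A.1.1 * Q) * P = A.1.1 := by
    rintro ⟨⟨A, hA⟩, h⟩
    have h1 := (rowSpace_le_iff_mul_mul_eq hPQ hW).1 h
    have h2 := congrArg Matrix.transpose h1
    simp only [Matrix.transpose_mul, hA.1, Matrix.mul_neg, neg_inj] at h2
    change Pᵀ * (Qᵀ * A * Q) * P = A
    rw [← Matrix.mul_assoc, ← Matrix.mul_assoc, Matrix.mul_assoc Pᵀ, h2, h1]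
  refine Nat.card_congr ⟨fun B => ⟨⟨Pᵀ * B.1 * P, B.2.congr P⟩, ?_⟩,
    fun A => ⟨Qᵀ * A.1.1 * Q, A.1.2.congr Q⟩, fun B => ?_, fun A => ?_⟩
  · rw [rowSpace_le_iff_mul_mul_eq hPQ hW, Matrix.mul_assoc _ P Q, hPQ, Matrix.mul_one]
  · have hPQ' : Qᵀ * Pᵀ = 1 := by rw [← Matrix.transpose_mul, hPQ, Matrix.transpose_one]
    apply Subtype.ext
    change Qᵀ * (Pᵀ * B.1 * P) * Q = B.1
    rw [Matrix.mul_assoc, Matrix.mul_assoc _ P Q, hPQ, Matrix.mul_one, ← Matrix.mul_assoc, hPQ',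
      Matrix.one_mul]
  · exact Subtype.ext (Subtype.ext (key A))

theorem card_isSkew_rank_eq [Finite F] (n r : ℕ) :
    (Nat.card {A : {A : Matrix (Fin n) (Fin n) F // IsSkew A} // A.1.rank = r} : ℚ)
      = gaussBinom (Nat.card F) n r * nondegAltCount (Nat.card F) r := by
  have h := card_finrank_eq (F := F)
    (fun A : {A : Matrix (Fin n) (Fin n) F // IsSkew A} => rowSpace A.1)
    (fun k => (Nat.card F : ℚ) ^ (k.choose 2)) (nondegAltCount (Nat.card F))
    (fun W => by rw [card_isSkew_rowSpace_le]; push_cast; rfl)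
    (fun k _ => sum_gaussBinom_nondegAltCount Finite.one_lt_card k) r
  simpa only [finrank_rowSpace, finrank_fin_fun] using h

/-- Over a finite field, the evenness of the rank can be read off from the number of alternating matrices of each
rank. -/
theorem IsSkew.even_rank [Finite F] {n : ℕ} {A : Matrix (Fin n) (Fin n) F} (hA : IsSkew A) :
    Even A.rank := by
  by_contra h
  have h1 := card_isSkew_rank_eq (F := F) n A.rank
  rw [nondegAltCount, if_neg h, mul_zero, Nat.cast_eq_zero, Finite.card_eq_zero_iff] at h1
  exact h1.elim ⟨⟨A, hA⟩, rfl⟩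

end Alternating

/-! ### An MRD code containing all alternating matrices -/

section MRDCode

open Matrix

variable {F E : Type*} [Field F] [Field E] [Algebra F E] {n : ℕ}

/-- The linear map `X ↦ ∑ X i t • (b i * p t)` on `n × k` matrices over `F`, for families `b` and `p`
of `n` and `k` elements of an extension field `E`. -/
def pairingMap {k : ℕ} (b : Fin n → E) (p : Fin k → E) : Matrix (Fin n) (Fin k) F →ₗ[F] E where
  toFun X := ∑ i, ∑ t, X i t • (b i * p t)
  map_add' X Y := by simp [add_smul, Finset.sum_add_distrib]
  map_smul' c X := by simp [mul_smul, Finset.smul_sum]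

theorem pairingMap_apply {k : ℕ} (b : Fin n → E) (p : Fin k → E) (X : Matrix (Fin n) (Fin k) F) :
    pairingMap b p X = ∑ i, ∑ t, X i t • (b i * p t) := rfl

theorem pairingMap_mul {k : ℕ} (b : Fin n → E) (X : Matrix (Fin n) (Fin k) F)
    (P : Matrix (Fin k) (Fin n) F) :
    pairingMap b b (X * P) = pairingMap b (fun t => ∑ j, P t j • b j) X := by
  simp only [pairingMap_apply, Matrix.mul_apply, Finset.sum_smul, Finset.mul_sum, Finset.smul_sum]
  refine Finset.sum_congr rfl fun i _ => ?_
  rw [Finset.sum_comm]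
  refine Finset.sum_congr rfl fun t _ => Finset.sum_congr rfl fun j _ => ?_
  rw [mul_smul, mul_smul_comm]

theorem pairingMap_surjective {k : ℕ} (b : Basis (Fin n) F E) {p : Fin k → E} {t : Fin k}
    (ht : p t ≠ 0) : Function.Surjective (pairingMap (F := F) b p) := by
  intro z
  refine ⟨Matrix.of fun i s => if s = t then b.repr (z / p t) i else 0, ?_⟩
  rw [pairingMap_apply]
  simp only [Matrix.of_apply, ite_smul, zero_smul, Finset.sum_ite_eq', Finset.mem_univ, if_true]
  have h := b.sum_repr (z / p t)
  calc ∑ i, b.repr (z / p t) i • (b i * p t)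
      = (∑ i, b.repr (z / p t) i • b i) * p t := by
        simp only [Finset.sum_mul, smul_mul_assoc]
    _ = z := by rw [h, div_mul_cancel₀ _ ht]

/-- The matrices `A` with `∑ A i j • (b i * b j) = 0`, where `b` is a basis of an extension field of
degree `n`.  The sum vanishes for alternating `A` by commutativity of `E`; for `A` of rank one it is
a product of two non-zero elements of `E`. -/
noncomputable def mrdCode (b : Basis (Fin n) F E) : Submodule F (Matrix (Fin n) (Fin n) F) :=
  LinearMap.ker (pairingMap b b)

theorem IsSkew.mem_mrdCode (b : Basis (Fin n) F E) {A : Matrix (Fin n) (Fin n) F}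
    (hA : IsSkew A) : A ∈ mrdCode b := by
  rw [isSkew_iff] at hA
  rw [mrdCode, LinearMap.mem_ker, pairingMap_apply, ← Fintype.sum_prod_type']
  refine Finset.sum_involution (fun p _ => p.swap) ?_ ?_ (by simp) (by simp)
  · intro p _
    simp only [Prod.fst_swap, Prod.snd_swap]
    rw [hA.1 p.1 p.2, mul_comm (b p.2), neg_smul, add_neg_cancel]
  · rintro ⟨i, j⟩ _ hne heq
    simp only [Prod.swap_prod_mk, Prod.mk.injEq] at heq
    obtain ⟨rfl, -⟩ := heq
    simp [hA.2] at hne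

/-- Matrices with rows in `W` are the products `X * P` with the rows of `P` a basis of `W`; on the
coefficient matrices `X` the defining condition is a surjective linear map to `E`, unless `W = 0`. -/
theorem card_mrdCode_rowSpace_le (b : Basis (Fin n) F E) (W : Submodule F (Fin n → F)) :
    Nat.card {A : mrdCode b // rowSpace A.1 ≤ W} = Nat.card F ^ (n * (finrank F W - 1)) := by
  obtain ⟨P, Q, hPQ, hW⟩ := exists_rowBasis W
  have : FiniteDimensional F E := b.finiteDimensional_of_finite
  set p : Fin (finrank F W) → E := fun t => ∑ j, P t j • b j with hp
  have e : Nat.card {A : mrdCode b // rowSpace A.1 ≤ W}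
      = Nat.card (LinearMap.ker (pairingMap (F := F) b p)) := by
    symm
    refine Nat.card_congr ⟨fun X => ⟨⟨X.1 * P, ?_⟩, ?_⟩, fun A => ⟨A.1.1 * Q, ?_⟩,
      fun X => ?_, fun A => ?_⟩
    · rw [mrdCode, LinearMap.mem_ker, pairingMap_mul]
      exact X.2
    · rw [rowSpace_le_iff_mul_mul_eq hPQ hW, Matrix.mul_assoc _ P Q, hPQ, Matrix.mul_one]
    · rw [LinearMap.mem_ker, hp, ← pairingMap_mul, (rowSpace_le_iff_mul_mul_eq hPQ hW).1 A.2]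
      exact A.1.2
    · apply Subtype.ext
      change X.1 * P * Q = X.1
      rw [Matrix.mul_assoc, hPQ, Matrix.mul_one]
    · exact Subtype.ext (Subtype.ext ((rowSpace_le_iff_mul_mul_eq hPQ hW).1 A.2))
  rw [e, Module.natCard_eq_pow_finrank (K := F)]
  congr 1
  have hdim := LinearMap.finrank_range_add_finrank_ker (pairingMap (F := F) b p)
  rw [Module.finrank_matrix, finrank_self, mul_one, Fintype.card_fin, Fintype.card_fin] at hdim
  rcases Nat.eq_zero_or_pos (finrank F W) with h0 | h0
  · have h1 : n * finrank F W = 0 := by rw [h0, mul_zero]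
    rw [show finrank F W - 1 = 0 by omega]
    omega
  · have hne : p ⟨0, h0⟩ ≠ 0 := by
      intro h
      have h1 : P ⟨0, h0⟩ = 0 :=
        funext fun j => Fintype.linearIndependent_iff.1 b.linearIndependent _ h j
      have h2 := congrFun (congrFun hPQ ⟨0, h0⟩) ⟨0, h0⟩
      rw [Matrix.mul_apply_eq_vecMul, h1, Matrix.zero_vecMul] at h2
      simp at h2
    rw [LinearMap.range_eq_top.2 (pairingMap_surjective b hne), finrank_top,
      finrank_eq_card_basis b, Fintype.card_fin] at hdim
    rw [Nat.mul_sub, mul_one]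
    omega

theorem two_le_rank_of_mem_mrdCode (b : Basis (Fin n) F E) {A : Matrix (Fin n) (Fin n) F}
    (hA : A ∈ mrdCode b) (h0 : A ≠ 0) : 2 ≤ A.rank := by
  by_contra hlt
  have h := card_mrdCode_rowSpace_le b (rowSpace A)
  rw [finrank_rowSpace, show A.rank - 1 = 0 by omega, mul_zero, pow_zero,
    Nat.card_eq_one_iff_unique] at h
  have := h.1.elim ⟨⟨A, hA⟩, le_rfl⟩ ⟨0, rowSpace_le_iff.2 fun _ => Submodule.zero_mem _⟩
  exact h0 (congrArg (fun x => x.1.1) this)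

theorem card_mrdCode (b : Basis (Fin n) F E) :
    Nat.card (mrdCode b) = Nat.card F ^ (n * (n - 1)) := by
  have h := card_mrdCode_rowSpace_le b ⊤
  rw [finrank_top, finrank_fin_fun] at h
  rw [← h]
  exact (Nat.card_congr (Equiv.subtypeUnivEquiv fun _ => le_top)).symm

variable [Finite F]

theorem exists_isSkew_rank_eq_two (hn : 2 ≤ n) :
    ∃ A : Matrix (Fin n) (Fin n) F, IsSkew A ∧ A.rank = 2 := by
  have h := card_isSkew_rank_eq (F := F) n 2
  have hq : 2 ≤ Nat.card F := Finite.one_lt_card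
  have hne : gaussBinom (Nat.card F) n 2 * nondegAltCount (Nat.card F) 2 ≠ 0 := by
    obtain ⟨m, rfl⟩ := Nat.exists_eq_add_of_le' hn
    have h1 := pow_sub_one_ne_zero hq one_ne_zero
    rw [gaussBinom_add hq]
    have := qFact_ne_zero hq
    simp [this, nondegAltCount]
    simpa using h1
  rw [← h] at hne
  have hne' : Nat.card {A : {A : Matrix (Fin n) (Fin n) F // IsSkew A} // A.1.rank = 2} ≠ 0 := by
    exact_mod_cast hne
  obtain ⟨A⟩ := (Nat.card_ne_zero.1 hne').1
  exact ⟨A.1.1, A.1.2, A.2⟩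

theorem isMRD_mrdCode (b : Basis (Fin n) F E) (hn : 2 ≤ n) :
    IsMRD (mrdCode b : Set (Matrix (Fin n) (Fin n) F)) 2 where
  minDist := by
    constructor
    · obtain ⟨A, hA, hr⟩ := exists_isSkew_rank_eq_two (F := F) hn
      refine ⟨A, hA.mem_mrdCode b, 0, Submodule.zero_mem _, ?_, by rw [sub_zero, hr]⟩
      rintro rfl
      simp at hr
    · rintro t ⟨X, hX, Y, hY, hne, rfl⟩
      exact two_le_rank_of_mem_mrdCode b (Submodule.sub_mem _ hX hY) (sub_ne_zero.2 hne)
  card := by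
    rw [show n - 2 + 1 = n - 1 by omega, ← card_mrdCode b]
    rfl

/-- The rank distribution of the MRD code. -/
theorem card_mrdCode_rank_eq (b : Basis (Fin n) F E) {r : ℕ} (hr : r ≠ 0) :
    (Nat.card {A : mrdCode b // A.1.rank = r} : ℚ)
      = gaussBinom (Nat.card F) n r * ∑ j ∈ Finset.Icc 2 r,
          (-1 : ℚ) ^ (r - j) * gaussBinom (Nat.card F) r j *
          (Nat.card F : ℚ) ^ ((r - j).choose 2) * ((Nat.card F : ℚ) ^ (n * (j - 1)) - 1) := by
  have : FiniteDimensional F E := b.finiteDimensional_of_finite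
  set q := Nat.card F with hqdef
  have hq : 2 ≤ q := Finite.one_lt_card
  -- The summands with `j = 0` and `j = 1` vanish, the former by truncated subtraction.
  set h : ℕ → ℚ := fun j => (q : ℚ) ^ (n * (j - 1)) - 1 with hh
  set s : ℕ → ℚ := fun r => ∑ j ∈ Finset.range (r + 1),
    (-1 : ℚ) ^ (r - j) * gaussBinom q r j * (q : ℚ) ^ ((r - j).choose 2) * h j with hs
  have hcount := card_finrank_eq (F := F)
    (fun A : mrdCode b => rowSpace A.1)
    (fun k => (q : ℚ) ^ (n * (k - 1))) (fun r => (if r = 0 then 1 else 0) + s r)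
    (fun W => by rw [card_mrdCode_rowSpace_le]; push_cast; rfl)
    (fun k _ => by
      rw [← hqdef]
      simp only [mul_add, Finset.sum_add_distrib]
      rw [sum_gaussBinom_inversion hq h k]
      simp [gaussBinom_zero_right, hh]) r
  simp only [finrank_rowSpace, finrank_fin_fun, if_neg hr, zero_add] at hcount
  rw [hcount]
  congr 1
  symm
  refine Finset.sum_subset (fun j hj => by simp at hj ⊢; omega) fun j hj hj' => ?_
  have : j - 1 = 0 := by simp at hj hj'; omega
  simp [this]

theorem exists_field_extension_basis (F : Type*) [Field F] [Finite F] {n : ℕ} (hn : n ≠ 0) :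
    ∃ (E : Type) (_ : Field E) (_ : Algebra F E), Nonempty (Basis (Fin n) F E) := by
  obtain ⟨p, hp⟩ := CharP.exists F
  have : Fact p.Prime := ⟨CharP.char_is_prime F p⟩
  have : NeZero n := ⟨hn⟩
  exact ⟨FiniteField.Extension F p n, inferInstance, inferInstance,
    ⟨finBasisOfFinrankEq F _ (FiniteField.finrank_extension F p n)⟩⟩

end MRDCode

/-! ### Subspaces of `F ^ n × F ^ n` -/

section Ambient

open Matrix

variable {F : Type*} [Field F] {n : ℕ}

theorem mem_spaceS {v : Ambient F n} : v ∈ spaceS F n ↔ v.1 = 0 := by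
  simp [spaceS, Submodule.mem_prod]

theorem mem_spaceS' {v : Ambient F n} : v ∈ spaceS' F n ↔ v.2 = 0 := by
  simp [spaceS', Submodule.mem_prod]

theorem mem_liftL {A : Matrix (Fin n) (Fin n) F} {v : Ambient F n} :
    v ∈ liftL A ↔ v.2 = v.1 ᵥ* A := by
  have key : ∀ c : Fin n → F, ∑ i, c i • ((Pi.single i 1, A i) : Ambient F n) = (c, c ᵥ* A) := by
    intro c
    rw [Prod.ext_iff, Prod.fst_sum, Prod.snd_sum]
    refine ⟨?_, ?_⟩
    · simpa using (pi_eq_sum_univ' c).symm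
    · rw [Matrix.vecMul_eq_sum]
      simp
  rw [liftL, Submodule.mem_span_range_iff_exists_fun]
  simp only [key]
  constructor
  · rintro ⟨c, rfl⟩
    rfl
  · intro h
    exact ⟨v.1, Prod.ext rfl h.symm⟩

theorem mem_liftL' {A : Matrix (Fin n) (Fin n) F} {v : Ambient F n} :
    v ∈ liftL' A ↔ v.1 = v.2 ᵥ* A := by
  have h : liftL' A = (liftL A).map (LinearEquiv.prodComm F (Fin n → F) (Fin n → F)).toLinearMap := by
    rw [liftL, Submodule.map_span, ← Set.range_comp]
    rfl
  rw [h, Submodule.mem_map_equiv, mem_liftL]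
  rfl

theorem hyperbolicForm_eq (v : Ambient F n) : hyperbolicForm F n v = v.1 ⬝ᵥ v.2 := rfl

theorem hyperbolicForm_polar (u v : Ambient F n) :
    hyperbolicForm F n (u + v) - hyperbolicForm F n u - hyperbolicForm F n v
      = u.1 ⬝ᵥ v.2 + v.1 ⬝ᵥ u.2 := by
  simp only [hyperbolicForm_eq, Prod.fst_add, Prod.snd_add, add_dotProduct, dotProduct_add]
  ring

theorem finrank_map_add_inf_ker {V V₂ : Type*} [AddCommGroup V] [Module F V]
    [FiniteDimensional F V] [AddCommGroup V₂] [Module F V₂] (f : V →ₗ[F] V₂) (U : Submodule F V) :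
    finrank F U = finrank F (U.map f) + finrank F ↥(U ⊓ LinearMap.ker f) := by
  have h := LinearMap.finrank_range_add_finrank_ker (f.domRestrict U)
  rw [LinearMap.range_domRestrict, LinearMap.ker_domRestrict] at h
  rw [← h, ← Submodule.map_comap_subtype, Submodule.finrank_map_subtype_eq]

theorem finrank_eq_fst_add (U : Submodule F (Ambient F n)) :
    finrank F U = finrank F (U.map (LinearMap.fst F (Fin n → F) (Fin n → F)))
      + finrank F ↥(U ⊓ spaceS F n) := by
  have h : spaceS F n = LinearMap.ker (LinearMap.fst F (Fin n → F) (Fin n → F)) :=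
    Submodule.ext fun v => mem_spaceS
  rw [h]
  exact finrank_map_add_inf_ker _ U

theorem finrank_eq_snd_add (U : Submodule F (Ambient F n)) :
    finrank F U = finrank F (U.map (LinearMap.snd F (Fin n → F) (Fin n → F)))
      + finrank F ↥(U ⊓ spaceS' F n) := by
  have h : spaceS' F n = LinearMap.ker (LinearMap.snd F (Fin n → F) (Fin n → F)) :=
    Submodule.ext fun v => mem_spaceS'
  rw [h]
  exact finrank_map_add_inf_ker _ U

theorem finrank_submodule_prod (p q : Submodule F (Fin n → F)) :
    finrank F ↥(p.prod q) = finrank F p + finrank F q := by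
  rw [finrank_eq_fst_add, Submodule.prod_map_fst, spaceS, Submodule.prod_inf_prod]
  congr 1
  rw [inf_bot_eq, inf_top_eq, finrank_eq_snd_add, Submodule.prod_map_snd, spaceS',
    Submodule.prod_inf_prod]
  simp

theorem finrank_spaceS : finrank F (spaceS F n) = n := by
  rw [spaceS, finrank_submodule_prod]; simp

theorem finrank_ambient : finrank F (Ambient F n) = 2 * n := by
  rw [finrank_prod]; simp; ring

theorem liftL_inf_spaceS (A : Matrix (Fin n) (Fin n) F) : liftL A ⊓ spaceS F n = ⊥ := by
  rw [eq_bot_iff]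
  rintro v ⟨h1, h2⟩
  rw [SetLike.mem_coe, mem_liftL] at h1
  rw [SetLike.mem_coe, mem_spaceS] at h2
  rw [h2, Matrix.zero_vecMul] at h1
  exact Prod.ext h2 h1

theorem liftL'_inf_spaceS' (A : Matrix (Fin n) (Fin n) F) : liftL' A ⊓ spaceS' F n = ⊥ := by
  rw [eq_bot_iff]
  rintro v ⟨h1, h2⟩
  rw [SetLike.mem_coe, mem_liftL'] at h1
  rw [SetLike.mem_coe, mem_spaceS'] at h2
  rw [h2, Matrix.zero_vecMul] at h1
  exact Prod.ext h1 h2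

theorem finrank_liftL (A : Matrix (Fin n) (Fin n) F) : finrank F (liftL A) = n := by
  rw [finrank_eq_fst_add, liftL_inf_spaceS, finrank_bot, add_zero]
  have : (liftL A).map (LinearMap.fst F (Fin n → F) (Fin n → F)) = ⊤ := by
    rw [eq_top_iff]
    intro x _
    exact ⟨(x, x ᵥ* A), mem_liftL.2 rfl, rfl⟩
  rw [this]
  simp

theorem finrank_liftL' (A : Matrix (Fin n) (Fin n) F) : finrank F (liftL' A) = n := by
  rw [finrank_eq_snd_add, liftL'_inf_spaceS', finrank_bot, add_zero]
  have : (liftL' A).map (LinearMap.snd F (Fin n → F) (Fin n → F)) = ⊤ := by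
    rw [eq_top_iff]
    intro x _
    exact ⟨(x ᵥ* A, x), mem_liftL'.2 rfl, rfl⟩
  rw [this]
  simp

theorem liftL_injective : Function.Injective (liftL : Matrix (Fin n) (Fin n) F → _) := by
  intro A B h
  refine Matrix.ext_iff_vecMul.2 fun x => ?_
  have : ((x, x ᵥ* A) : Ambient F n) ∈ liftL B := h ▸ mem_liftL.2 rfl
  exact mem_liftL.1 this

theorem liftL'_injective : Function.Injective (liftL' : Matrix (Fin n) (Fin n) F → _) := by
  intro A B h
  refine Matrix.ext_iff_vecMul.2 fun x => ?_
  have : ((x ᵥ* A, x) : Ambient F n) ∈ liftL' B := h ▸ mem_liftL'.2 rfl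
  exact mem_liftL'.1 this

theorem finrank_ker_vecMul {k : ℕ} (A : Matrix (Fin k) (Fin n) F) :
    finrank F (LinearMap.ker A.vecMulLinear) + A.rank = k := by
  have h := LinearMap.finrank_range_add_finrank_ker (Aᵀ.mulVecLin)
  rw [← Matrix.rank, Matrix.rank_transpose, finrank_fin_fun] at h
  rw [Matrix.mulVecLin_transpose] at h
  omega

theorem finrank_liftL'_inf_spaceS (A : Matrix (Fin n) (Fin n) F) :
    finrank F ↥(liftL' A ⊓ spaceS F n) + A.rank = n := by
  have h := finrank_eq_fst_add (liftL' A)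
  rw [finrank_liftL'] at h
  have : (liftL' A).map (LinearMap.fst F (Fin n → F) (Fin n → F)) = rowSpace A := by
    ext x
    rw [rowSpace, ← range_vecMulLinear]
    constructor
    · rintro ⟨v, hv, rfl⟩
      exact ⟨v.2, (mem_liftL'.1 hv).symm⟩
    · rintro ⟨c, rfl⟩
      exact ⟨(c ᵥ* A, c), mem_liftL'.2 rfl, rfl⟩
  rw [this, finrank_rowSpace] at h
  omega

/-- The orthogonal complement with respect to the dot product. -/
def dotOrth (W : Submodule F (Fin n → F)) : Submodule F (Fin n → F) where
  carrier := {y | ∀ x ∈ W, x ⬝ᵥ y = 0}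
  add_mem' ha hb x hx := by rw [dotProduct_add, ha x hx, hb x hx, add_zero]
  zero_mem' x _ := dotProduct_zero x
  smul_mem' c y hy x hx := by rw [dotProduct_smul, hy x hx, smul_zero]

theorem mem_dotOrth {W : Submodule F (Fin n → F)} {y : Fin n → F} :
    y ∈ dotOrth W ↔ ∀ x ∈ W, x ⬝ᵥ y = 0 := Iff.rfl

theorem le_dotOrth_comm {U W : Submodule F (Fin n → F)} : U ≤ dotOrth W ↔ W ≤ dotOrth U :=
  ⟨fun h x hx y hy => (dotProduct_comm y x).trans (h hy x hx),
    fun h x hx y hy => (dotProduct_comm y x).trans (h hy x hx)⟩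

theorem dotOrth_sup (U W : Submodule F (Fin n → F)) :
    dotOrth (U ⊔ W) = dotOrth U ⊓ dotOrth W := by
  refine eq_of_forall_le_iff fun Z => ?_
  rw [le_inf_iff, le_dotOrth_comm, sup_le_iff, le_dotOrth_comm, le_dotOrth_comm (W := W)]

theorem mem_dotOrth_iff_mulVec {k : ℕ} {W : Submodule F (Fin n → F)} {P : Matrix (Fin k) (Fin n) F}
    (hW : ∀ x, x ∈ W ↔ ∃ c, c ᵥ* P = x) {y : Fin n → F} : y ∈ dotOrth W ↔ P *ᵥ y = 0 := by
  rw [mem_dotOrth]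
  constructor
  · intro h
    refine dotProduct_eq_zero _ fun c => ?_
    rw [dotProduct_comm, dotProduct_mulVec]
    exact h _ ((hW _).2 ⟨c, rfl⟩)
  · intro h x hx
    obtain ⟨c, rfl⟩ := (hW x).1 hx
    rw [← dotProduct_mulVec, h, dotProduct_zero]

theorem finrank_dotOrth_add (W : Submodule F (Fin n → F)) :
    finrank F (dotOrth W) + finrank F W = n := by
  obtain ⟨P, Q, hPQ, hW⟩ := exists_rowBasis W
  have h := LinearMap.finrank_range_add_finrank_ker P.mulVecLin
  have h1 : dotOrth W = LinearMap.ker P.mulVecLin := by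
    ext y
    rw [mem_dotOrth_iff_mulVec hW]
    rfl
  have h2 : LinearMap.range P.mulVecLin = ⊤ := by
    rw [eq_top_iff]
    intro c _
    exact ⟨Q *ᵥ c, by simp [hPQ]⟩
  rw [h2, finrank_top, finrank_fin_fun, finrank_fin_fun] at h
  rw [h1]
  omega

/-- Two subspaces, one of which misses `T`. -/
theorem finrank_inf_add_inf_le {V : Type*} [AddCommGroup V] [Module F V] [FiniteDimensional F V]
    (U U' T : Submodule F V) (h : U' ⊓ T = ⊥) :
    finrank F ↥(U ⊓ U') + finrank F ↥(U ⊓ T) ≤ finrank F U := by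
  have h1 := Submodule.finrank_sup_add_finrank_inf_eq (U ⊓ U') (U ⊓ T)
  have h2 : (U ⊓ U') ⊓ (U ⊓ T) = ⊥ := by
    rw [eq_bot_iff, ← h]
    exact inf_le_inf inf_le_right inf_le_right
  rw [h2, finrank_bot, add_zero] at h1
  rw [← h1]
  exact Submodule.finrank_mono (sup_le inf_le_left inf_le_left)

end Ambient

/-! ### Generators of the hyperbolic quadric -/

section Generators

open Matrix

variable {F : Type*} [Field F] {n : ℕ}

/-- The projection of a subspace of `F ^ n × F ^ n` to the first `n` coordinates. -/
def fstProj (U : Submodule F (Ambient F n)) : Submodule F (Fin n → F) :=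
  U.map (LinearMap.fst F (Fin n → F) (Fin n → F))

theorem mem_fstProj {U : Submodule F (Ambient F n)} {x : Fin n → F} :
    x ∈ fstProj U ↔ ∃ y, (x, y) ∈ U :=
  ⟨fun ⟨v, hv, h⟩ => ⟨v.2, h ▸ hv⟩, fun ⟨_, h⟩ => ⟨_, h, rfl⟩⟩

theorem dotProduct_add_eq_zero_of_mem {U : Submodule F (Ambient F n)}
    (hU : ∀ v ∈ U, hyperbolicForm F n v = 0) {u v : Ambient F n} (hu : u ∈ U) (hv : v ∈ U) :
    u.1 ⬝ᵥ v.2 + v.1 ⬝ᵥ u.2 = 0 := by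
  rw [← hyperbolicForm_polar, hU _ (U.add_mem hu hv), hU _ hu, hU _ hv]
  ring

/-- The generator of the quadric with first projection the row space of `P` and alternating form
`B` on it, written in the basis given by the rows of `P`; the matrix `Q` is a right inverse
of `P`. -/
def genOf {k : ℕ} (P : Matrix (Fin k) (Fin n) F) (Q : Matrix (Fin n) (Fin k) F)
    (B : Matrix (Fin k) (Fin k) F) : Submodule F (Ambient F n) where
  carrier := {v | v.1 ᵥ* (Q * P) = v.1 ∧ P *ᵥ v.2 = v.1 ᵥ* (Q * B)}
  add_mem' := by
    rintro u v ⟨h1, h2⟩ ⟨h3, h4⟩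
    simp only [Set.mem_ofPred_eq, Prod.fst_add, Prod.snd_add, add_vecMul, mulVec_add]
    exact ⟨by rw [h1, h3], by rw [h2, h4]⟩
  zero_mem' := by simp
  smul_mem' := by
    rintro c v ⟨h1, h2⟩
    simp only [Set.mem_ofPred_eq, Prod.smul_fst, Prod.smul_snd, smul_vecMul, mulVec_smul]
    exact ⟨by rw [h1], by rw [h2]⟩

variable {k : ℕ} {P : Matrix (Fin k) (Fin n) F} {Q : Matrix (Fin n) (Fin k) F}

theorem mem_genOf (hPQ : P * Q = 1) {B : Matrix (Fin k) (Fin k) F} {v : Ambient F n} :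
    v ∈ genOf P Q B ↔ ∃ c, c ᵥ* P = v.1 ∧ P *ᵥ v.2 = c ᵥ* B := by
  constructor
  · rintro ⟨h1, h2⟩
    exact ⟨v.1 ᵥ* Q, by rw [vecMul_vecMul, h1], by rw [vecMul_vecMul, h2]⟩
  · rintro ⟨c, h1, h2⟩
    have h3 : v.1 ᵥ* Q = c := by rw [← h1, vecMul_vecMul, hPQ, vecMul_one]
    exact ⟨by rw [← vecMul_vecMul, h3, h1], by rw [← vecMul_vecMul, h3, h2]⟩

theorem mk_mem_genOf (hPQ : P * Q = 1) (B : Matrix (Fin k) (Fin k) F) (c : Fin k → F) :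
    ((c ᵥ* P, Q *ᵥ (c ᵥ* B)) : Ambient F n) ∈ genOf P Q B :=
  (mem_genOf hPQ).2 ⟨c, rfl, by rw [mulVec_mulVec, hPQ, one_mulVec]⟩

theorem vecMul_right_injective (hPQ : P * Q = 1) : Function.Injective fun c => c ᵥ* P := by
  intro c d h
  have := congrArg (fun x => x ᵥ* Q) h
  simpa [vecMul_vecMul, hPQ] using this

variable {W : Submodule F (Fin n → F)}

theorem fstProj_genOf (hPQ : P * Q = 1) (hW : ∀ x, x ∈ W ↔ ∃ c, c ᵥ* P = x)
    (B : Matrix (Fin k) (Fin k) F) : fstProj (genOf P Q B) = W := by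
  ext x
  rw [mem_fstProj, hW]
  constructor
  · rintro ⟨y, hy⟩
    obtain ⟨c, hc, -⟩ := (mem_genOf hPQ).1 hy
    exact ⟨c, hc⟩
  · rintro ⟨c, rfl⟩
    exact ⟨_, mk_mem_genOf hPQ B c⟩

theorem genOf_inf_spaceS (hPQ : P * Q = 1) (hW : ∀ x, x ∈ W ↔ ∃ c, c ᵥ* P = x)
    (B : Matrix (Fin k) (Fin k) F) :
    genOf P Q B ⊓ spaceS F n = Submodule.prod ⊥ (dotOrth W) := by
  ext v
  rw [Submodule.mem_inf, mem_spaceS, Submodule.mem_prod, Submodule.mem_bot,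
    mem_dotOrth_iff_mulVec hW, mem_genOf hPQ, and_comm]
  refine and_congr_right fun h0 => ?_
  rw [h0]
  constructor
  · rintro ⟨c, h1, h2⟩
    have : c = 0 := vecMul_right_injective hPQ (by simpa using h1)
    rw [h2, this, zero_vecMul]
  · intro h
    exact ⟨0, by simp, by rw [h, zero_vecMul]⟩

theorem finrank_genOf (hPQ : P * Q = 1) (hW : ∀ x, x ∈ W ↔ ∃ c, c ᵥ* P = x)
    (B : Matrix (Fin k) (Fin k) F) : finrank F (genOf P Q B) = n := by
  rw [finrank_eq_fst_add, ← fstProj, fstProj_genOf hPQ hW, genOf_inf_spaceS hPQ hW,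
    finrank_submodule_prod, finrank_bot, zero_add, add_comm, finrank_dotOrth_add]

theorem isGenerator_genOf (hPQ : P * Q = 1) (hW : ∀ x, x ∈ W ↔ ∃ c, c ᵥ* P = x)
    {B : Matrix (Fin k) (Fin k) F} (hB : IsSkew B) : IsGenerator (genOf P Q B) := by
  refine ⟨fun v hv => ?_, finrank_genOf hPQ hW B⟩
  obtain ⟨c, h1, h2⟩ := (mem_genOf hPQ).1 hv
  rw [hyperbolicForm_eq, ← h1, ← dotProduct_mulVec, h2, dotProduct_comm, ← dotProduct_mulVec,
    hB.dotProduct_mulVec_self]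

theorem genOf_injective (hPQ : P * Q = 1) :
    Function.Injective (genOf P Q : Matrix (Fin k) (Fin k) F → _) := by
  intro B B' h
  refine Matrix.ext_iff_vecMul.2 fun c => ?_
  have h1 := mk_mem_genOf hPQ B c
  rw [h] at h1
  obtain ⟨d, h2, h3⟩ := (mem_genOf hPQ).1 h1
  have h4 : d = c := vecMul_right_injective hPQ h2
  rw [mulVec_mulVec, hPQ, one_mulVec, h4] at h3
  exact h3

/-- For `x` in the first projection of a generator `U`, the vectors `y` with `(x, y) ∈ U` all have
the same products with that projection, so that `U` induces a bilinear form on it, which is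
alternating because `U` is totally singular. -/
theorem IsGenerator.exists_eq_genOf {U : Submodule F (Ambient F n)} (hU : IsGenerator U)
    (hPQ : P * Q = 1) (hW : ∀ x, x ∈ fstProj U ↔ ∃ c, c ᵥ* P = x) :
    ∃ B : Matrix (Fin k) (Fin k) F, IsSkew B ∧ genOf P Q B = U := by
  have hex : ∀ i, ∃ y, ((P i, y) : Ambient F n) ∈ U := fun i =>
    mem_fstProj.1 ((hW _).2 ⟨Pi.single i 1, single_one_vecMul i P⟩)
  choose y hy using hex
  let Y : Matrix (Fin k) (Fin n) F := Matrix.of y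
  have hY : ∀ c, ((c ᵥ* P, c ᵥ* Y) : Ambient F n) ∈ U := by
    intro c
    have h := U.sum_mem fun i (_ : i ∈ Finset.univ) => U.smul_mem (c i) (hy i)
    convert h using 1
    rw [Prod.ext_iff, Prod.fst_sum, Prod.snd_sum]
    exact ⟨vecMul_eq_sum c P, vecMul_eq_sum c Y⟩
  have hB : IsSkew (Y * Pᵀ) := by
    rw [isSkew_iff_forall]
    intro c
    have := hU.1 _ (hY c)
    rw [hyperbolicForm_eq] at this
    rw [← mulVec_mulVec, mulVec_transpose, dotProduct_mulVec, dotProduct_comm]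
    exact this
  refine ⟨Y * Pᵀ, hB, ?_⟩
  symm
  refine Submodule.eq_of_le_of_finrank_eq (fun v hv => ?_) (hU.2.trans (finrank_genOf hPQ hW _).symm)
  obtain ⟨c, hc⟩ := (hW _).1 (mem_fstProj.2 ⟨v.2, hv⟩)
  refine (mem_genOf hPQ).2 ⟨c, hc, ?_⟩
  rw [← vecMul_vecMul, vecMul_transpose, ← sub_eq_zero, ← mulVec_sub,
    ← mem_dotOrth_iff_mulVec hW, mem_dotOrth]
  intro x hx
  obtain ⟨d, rfl⟩ := (hW x).1 hx
  have h1 := U.sub_mem hv (hY c)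
  have h2 := dotProduct_add_eq_zero_of_mem hU.1 (hY d) h1
  simp only [Prod.fst_sub, Prod.snd_sub, hc, sub_self, zero_dotProduct, add_zero] at h2
  exact h2

theorem finrank_genOf_inf_spaceS' (hPQ : P * Q = 1) (B : Matrix (Fin k) (Fin k) F) :
    finrank F ↥(genOf P Q B ⊓ spaceS' F n) + B.rank = k := by
  have h1 : genOf P Q B ⊓ spaceS' F n = (LinearMap.ker B.vecMulLinear).map
      ((LinearMap.inl F (Fin n → F) (Fin n → F)) ∘ₗ P.vecMulLinear) := by
    ext v
    rw [Submodule.mem_inf, mem_spaceS', mem_genOf hPQ, Submodule.mem_map]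
    constructor
    · rintro ⟨⟨c, h1, h2⟩, h3⟩
      rw [h3, mulVec_zero] at h2
      exact ⟨c, h2.symm, Prod.ext h1 h3.symm⟩
    · rintro ⟨c, h1, rfl⟩
      refine ⟨⟨c, rfl, ?_⟩, rfl⟩
      rw [show c ᵥ* B = 0 from h1]
      simp
  have h2 : Function.Injective
      ((LinearMap.inl F (Fin n → F) (Fin n → F)) ∘ₗ P.vecMulLinear) :=
    LinearMap.inl_injective.comp (vecMul_right_injective hPQ)
  rw [h1, ← (Submodule.equivMapOfInjective _ h2 _).finrank_eq, finrank_ker_vecMul]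

theorem card_generators_fstProj_eq [Finite F] (W : Submodule F (Fin n → F)) :
    Nat.card {U : Submodule F (Ambient F n) // IsGenerator U ∧ fstProj U = W}
      = Nat.card F ^ ((finrank F W).choose 2) := by
  obtain ⟨P, Q, hPQ, hW⟩ := exists_rowBasis W
  rw [← card_isSkew]
  symm
  refine Nat.card_congr (Equiv.ofBijective (fun B => ⟨genOf P Q B.1, isGenerator_genOf hPQ hW B.2,
    fstProj_genOf hPQ hW B.1⟩) ⟨fun B B' h => ?_, ?_⟩)
  · exact Subtype.ext (genOf_injective hPQ (congrArg Subtype.val h))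
  · rintro ⟨U, hU, rfl⟩
    obtain ⟨B, hB, h⟩ := hU.exists_eq_genOf hPQ hW
    exact ⟨⟨B, hB⟩, Subtype.ext h⟩

theorem IsGenerator.inf_spaceS {U : Submodule F (Ambient F n)} (hU : IsGenerator U) :
    U ⊓ spaceS F n = Submodule.prod ⊥ (dotOrth (fstProj U)) := by
  obtain ⟨P, Q, hPQ, hW⟩ := exists_rowBasis (fstProj U)
  obtain ⟨B, hB, h⟩ := hU.exists_eq_genOf hPQ hW
  rw [← genOf_inf_spaceS hPQ hW B, h]

theorem IsGenerator.finrank_inf_spaceS {U : Submodule F (Ambient F n)} (hU : IsGenerator U) :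
    finrank F ↥(U ⊓ spaceS F n) + finrank F (fstProj U) = n := by
  have := finrank_eq_fst_add U
  rw [hU.2, ← fstProj] at this
  omega

theorem IsGenerator.even_finrank_inf_spaceS' [Finite F] {U : Submodule F (Ambient F n)}
    (hU : IsGenerator U) (he : Even (finrank F (fstProj U))) :
    Even (finrank F ↥(U ⊓ spaceS' F n)) := by
  obtain ⟨P, Q, hPQ, hW⟩ := exists_rowBasis (fstProj U)
  obtain ⟨B, hB, h⟩ := hU.exists_eq_genOf hPQ hW
  have h1 := finrank_genOf_inf_spaceS' hPQ B
  rw [h] at h1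
  rw [← h1, Nat.even_add] at he
  exact he.2 hB.even_rank

theorem IsGenerator.sameSystem_spaceS_iff {U : Submodule F (Ambient F n)} (hU : IsGenerator U) :
    SameSystem U (spaceS F n) ↔ Even (finrank F (fstProj U)) := by
  have := hU.finrank_inf_spaceS
  rw [SameSystem, show n - finrank F ↥(U ⊓ spaceS F n) = finrank F (fstProj U) by omega]

/-- The generators disjoint from `S'` are the lifts `L'(A)` of the alternating matrices. -/
theorem isGenerator_and_inf_spaceS'_eq_bot_iff {U : Submodule F (Ambient F n)} :
    (IsGenerator U ∧ U ⊓ spaceS' F n = ⊥) ↔ ∃ A, IsSkew A ∧ liftL' A = U := by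
  constructor
  · rintro ⟨hU, h0⟩
    have h1 := finrank_eq_snd_add U
    rw [h0, finrank_bot, add_zero, hU.2] at h1
    have h2 : U.map (LinearMap.snd F (Fin n → F) (Fin n → F)) = ⊤ :=
      Submodule.eq_top_of_finrank_eq (by rw [← h1]; simp)
    have hex : ∀ i : Fin n, ∃ x, ((x, Pi.single i 1) : Ambient F n) ∈ U := by
      intro i
      have : (Pi.single i 1 : Fin n → F) ∈ U.map (LinearMap.snd F (Fin n → F) (Fin n → F)) := by
        rw [h2]; trivial
      obtain ⟨v, hv, hv'⟩ := this
      exact ⟨v.1, by rw [← hv']; exact hv⟩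
    choose a ha using hex
    have hle : liftL' (Matrix.of a) ≤ U := by
      rw [liftL', Submodule.span_le]
      rintro _ ⟨i, rfl⟩
      exact ha i
    have heq := Submodule.eq_of_le_of_finrank_eq hle (by rw [finrank_liftL', hU.2])
    refine ⟨Matrix.of a, ?_, heq⟩
    rw [isSkew_iff_forall]
    intro x
    have := hU.1 (x ᵥ* Matrix.of a, x) (heq ▸ mem_liftL'.2 rfl)
    rw [hyperbolicForm_eq] at this
    rw [dotProduct_mulVec]
    exact this
  · rintro ⟨A, hA, rfl⟩
    refine ⟨⟨fun v hv => ?_, finrank_liftL' A⟩, liftL'_inf_spaceS' A⟩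
    rw [hyperbolicForm_eq, mem_liftL'.1 hv, ← dotProduct_mulVec, hA.dotProduct_mulVec_self]

end Generators

/-! ### The number of codewords of each kind -/

section Counting

open Matrix

variable {F : Type*} [Field F] {n : ℕ}

theorem isGenerator_liftL' {A : Matrix (Fin n) (Fin n) F} (hA : IsSkew A) :
    IsGenerator (liftL' A) :=
  (isGenerator_and_inf_spaceS'_eq_bot_iff.2 ⟨A, hA, rfl⟩).1

theorem finrank_fstProj_liftL' {A : Matrix (Fin n) (Fin n) F} (hA : IsSkew A) :
    finrank F (fstProj (liftL' A)) = A.rank := by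
  have h1 := (isGenerator_liftL' hA).finrank_inf_spaceS
  have h2 := finrank_liftL'_inf_spaceS A
  omega

theorem ncard_image_liftL' (p : Matrix (Fin n) (Fin n) F → Prop) :
    (liftL' '' {A | p A}).ncard = Nat.card {A // p A} := by
  rw [Set.ncard_image_of_injective _ liftL'_injective]
  rfl

variable [Finite F]

/-- Half of all generators: the `q`-binomial theorem at `1` and at `-1`. -/
theorem card_generators_even (hn : 1 ≤ n) :
    (Nat.card {U : Submodule F (Ambient F n) // IsGenerator U ∧ Even (finrank F (fstProj U))} : ℚ)
      = ∏ i ∈ Finset.Icc 1 (n - 1), ((Nat.card F : ℚ) ^ i + 1) := by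
  classical
  have := finite_submodule F (Ambient F n)
  have := finite_submodule F (Fin n → F)
  have := Fintype.ofFinite (Submodule F (Ambient F n))
  have := Fintype.ofFinite (Submodule F (Fin n → F))
  rw [← sum_even_gaussBinom Finite.one_lt_card hn, Finset.sum_filter,
    Nat.card_eq_fintype_card, Fintype.card_subtype,
    Finset.card_eq_sum_card_fiberwise (f := fstProj) (t := Finset.univ) (fun _ _ => by simp)]
  have h := sum_subspaces_le (F := F) (⊤ : Submodule F (Fin n → F))
    (fun k => if Even k then (Nat.card F : ℚ) ^ (k.choose 2) else 0)
  rw [finrank_top, finrank_fin_fun] at h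
  simp only [mul_ite, mul_zero] at h
  rw [← h]
  simp only [le_top, Finset.filter_true]
  push_cast
  refine Finset.sum_congr rfl fun W _ => ?_
  split_ifs with he
  · rw [← Nat.cast_pow, ← card_generators_fstProj_eq, Nat.card_eq_fintype_card,
      Fintype.card_subtype, Finset.filter_filter]
    congr 2
    ext U
    simp only [Finset.mem_filter, Finset.mem_univ, true_and]
    constructor
    · rintro ⟨⟨h1, -⟩, h2⟩
      exact ⟨h1, h2⟩
    · rintro ⟨h1, rfl⟩
      exact ⟨⟨h1, he⟩, rfl⟩
  · rw [Nat.cast_eq_zero, Finset.card_eq_zero, Finset.filter_filter]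
    refine Finset.filter_false_of_mem fun U _ h => he ?_
    rw [← h.2]
    exact h.1.2

/-- The system of `S`, without the generators disjoint from `S'` that do not meet `S` in a point.  No
member of the system is disjoint from `S`, as `n` is odd. -/
theorem ncard_generatorPart (hn : 3 ≤ n) (hodd : Odd n) :
    ((generatorPart F n).ncard : ℚ)
      = ∏ i ∈ Finset.Icc 1 (n - 1), ((Nat.card F : ℚ) ^ i + 1)
        - (Nat.card F : ℚ) ^ (n * (n - 1) / 2)
        + (Nat.card F : ℚ) ^ ((n - 1) * (n - 3) / 4)
          * ∏ i ∈ Finset.Icc 1 ((n - 1) / 2), ((Nat.card F : ℚ) ^ (2 * i + 1) - 1) := by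
  have := finite_submodule F (Ambient F n)
  set G : Set (Submodule F (Ambient F n)) := {U | IsGenerator U ∧ Even (finrank F (fstProj U))}
    with hG
  set G₀ : Set (Submodule F (Ambient F n)) := liftL' '' {A | IsSkew A} with hG₀
  set G₁ : Set (Submodule F (Ambient F n)) := liftL' '' {A | IsSkew A ∧ A.rank = n - 1} with hG₁
  have hG₀G : G₀ ⊆ G := by
    rintro _ ⟨A, hA, rfl⟩
    exact ⟨isGenerator_liftL' hA, by rw [finrank_fstProj_liftL' hA]; exact IsSkew.even_rank hA⟩
  have hG₁G₀ : G₁ ⊆ G₀ := Set.image_mono fun A hA => hA.1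
  have hpart : generatorPart F n = (G \ G₀) ∪ G₁ := by
    ext U
    constructor
    · rintro ⟨hU, hs, ⟨h1, h2⟩ | ⟨h1, h2⟩⟩
      · obtain ⟨A, hA, rfl⟩ := isGenerator_and_inf_spaceS'_eq_bot_iff.1 ⟨hU, h1⟩
        have := finrank_liftL'_inf_spaceS A
        exact Or.inr ⟨A, ⟨hA, by omega⟩, rfl⟩
      · refine Or.inl ⟨⟨hU, hU.sameSystem_spaceS_iff.1 hs⟩, fun h => h2 ?_⟩
        exact (isGenerator_and_inf_spaceS'_eq_bot_iff.2 h).2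
    · rintro (⟨⟨hU, he⟩, h0⟩ | ⟨A, ⟨hA, hr⟩, rfl⟩)
      · refine ⟨hU, hU.sameSystem_spaceS_iff.2 he, Or.inr ⟨fun h => ?_, fun h => ?_⟩⟩
        · have h1 := hU.finrank_inf_spaceS
          rw [h, finrank_bot, zero_add] at h1
          rw [h1] at he
          exact Nat.not_even_iff_odd.2 hodd he
        · exact h0 (isGenerator_and_inf_spaceS'_eq_bot_iff.1 ⟨hU, h⟩)
      · have hU := isGenerator_liftL' hA
        refine ⟨hU, hU.sameSystem_spaceS_iff.2 ?_, Or.inl ⟨liftL'_inf_spaceS' A, ?_⟩⟩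
        · rw [finrank_fstProj_liftL' hA]
          exact hA.even_rank
        · have := finrank_liftL'_inf_spaceS A
          omega
  have hdisj : Disjoint (G \ G₀) G₁ := Set.disjoint_left.2 fun U h1 h2 => h1.2 (hG₁G₀ h2)
  have c1 : (G.ncard : ℚ) = ∏ i ∈ Finset.Icc 1 (n - 1), ((Nat.card F : ℚ) ^ i + 1) :=
    card_generators_even (by omega)
  have c2 : G₀.ncard = Nat.card F ^ (n * (n - 1) / 2) := by
    rw [hG₀, ncard_image_liftL', card_isSkew, Nat.choose_two_right]
  have c3 : (G₁.ncard : ℚ) = (Nat.card F : ℚ) ^ ((n - 1) * (n - 3) / 4)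
      * ∏ i ∈ Finset.Icc 1 ((n - 1) / 2), ((Nat.card F : ℚ) ^ (2 * i + 1) - 1) := by
    rw [← gaussBinom_mul_nondegAltCount_pred Finite.one_lt_card hodd, ← card_isSkew_rank_eq,
      hG₁, ncard_image_liftL']
    congr 1
    exact (Nat.card_congr (Equiv.subtypeSubtypeEquivSubtypeInter IsSkew
      fun A : Matrix (Fin n) (Fin n) F => A.rank = n - 1)).symm
  have c4 := Set.ncard_sdiff_add_ncard_of_subset hG₀G
  rw [hpart, Set.ncard_union_eq hdisj, Nat.cast_add, c3, ← c1, ← c4, c2]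
  push_cast
  ring

variable {E : Type*} [Field E] [Algebra F E]

theorem ncard_liftedPart (b : Basis (Fin n) F E) :
    ((liftedPart (mrdCode b : Set (Matrix (Fin n) (Fin n) F))).ncard : ℚ)
      = (Nat.card F : ℚ) ^ (n ^ 2 - n) - (Nat.card F : ℚ) ^ (n * (n - 1) / 2) := by
  have h1 : liftedPart (mrdCode b : Set (Matrix (Fin n) (Fin n) F))
      = liftL '' ((mrdCode b : Set (Matrix (Fin n) (Fin n) F)) \ {A | IsSkew A}) := by
    ext U
    exact ⟨fun ⟨A, h1, h2, h3⟩ => ⟨A, ⟨h1, h2⟩, h3⟩, fun ⟨A, ⟨h1, h2⟩, h3⟩ => ⟨A, h1, h2, h3⟩⟩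
  have h2 := Set.ncard_sdiff_add_ncard_of_subset
    (show {A | IsSkew A} ⊆ (mrdCode b : Set (Matrix (Fin n) (Fin n) F)) from
      fun A hA => IsSkew.mem_mrdCode b hA)
  have h3 : ({A | IsSkew A} : Set (Matrix (Fin n) (Fin n) F)).ncard
      = Nat.card F ^ (n * (n - 1) / 2) := by
    rw [← Nat.choose_two_right, ← card_isSkew]
    rfl
  have h4 : (mrdCode b : Set (Matrix (Fin n) (Fin n) F)).ncard = Nat.card F ^ (n ^ 2 - n) := by
    rw [sq, ← Nat.mul_sub_one, ← card_mrdCode b]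
    rfl
  rw [h1, Set.ncard_image_of_injective _ liftL_injective, ← Nat.cast_pow, ← Nat.cast_pow, ← h3,
    ← h4, ← h2]
  push_cast
  ring

theorem ncard_constantRankPart (b : Basis (Fin n) F E) :
    ((constantRankPart (mrdCode b : Set (Matrix (Fin n) (Fin n) F))).ncard : ℚ)
      = ∑ r ∈ Finset.Icc 2 (n - 2), gaussBinom (Nat.card F) n r * ∑ j ∈ Finset.Icc 2 r,
          (-1 : ℚ) ^ (r - j) * gaussBinom (Nat.card F) r j *
          (Nat.card F : ℚ) ^ ((r - j).choose 2) * ((Nat.card F : ℚ) ^ (n * (j - 1)) - 1) := by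
  classical
  have := Fintype.ofFinite (mrdCode b)
  have h1 : constantRankPart (mrdCode b : Set (Matrix (Fin n) (Fin n) F))
      = (fun A : mrdCode b => liftL' A.1) '' {A | A.1.rank ∈ Finset.Icc 2 (n - 2)} := by
    ext U
    constructor
    · rintro ⟨A, h1, h2, h3, h4⟩
      exact ⟨⟨A, h1⟩, Finset.mem_Icc.2 ⟨h2, h3⟩, h4⟩
    · rintro ⟨A, h1, h2⟩
      exact ⟨A.1, A.2, (Finset.mem_Icc.1 h1).1, (Finset.mem_Icc.1 h1).2, h2⟩
  have hinj : Function.Injective fun A : mrdCode b => liftL' A.1 :=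
    liftL'_injective.comp Subtype.val_injective
  rw [h1, Set.ncard_image_of_injective _ hinj,
    Set.ncard_eq_toFinset_card', Set.toFinset_ofPred,
    Finset.card_eq_sum_card_fiberwise (f := fun A : mrdCode b => A.1.rank)
      (t := Finset.Icc 2 (n - 2)) (fun A hA => by simpa using hA)]
  push_cast
  refine Finset.sum_congr rfl fun r hr => ?_
  rw [← card_mrdCode_rank_eq b (by have := Finset.mem_Icc.1 hr; omega),
    Nat.card_eq_fintype_card, Fintype.card_subtype, Finset.filter_filter]
  congr 2
  ext A
  simp only [Finset.mem_filter, Finset.mem_univ, true_and, and_iff_right_iff_imp]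
  rintro rfl
  exact hr

end Counting

/-! ### Intersections of codewords -/

section Intersections

open Matrix

variable {F : Type*} [Field F] {n : ℕ}

theorem subspaceDist_eq {U U' : Submodule F (Ambient F n)} (hU : finrank F U = n)
    (hU' : finrank F U' = n) : subspaceDist U U' = 2 * (n - finrank F ↥(U ⊓ U')) := by
  have h := Submodule.finrank_sup_add_finrank_inf_eq U U'
  have h1 := Submodule.finrank_mono (inf_le_left : U ⊓ U' ≤ U)
  rw [subspaceDist]
  omega

theorem finrank_liftL_inf_liftL_add_rank_le (A B : Matrix (Fin n) (Fin n) F) :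
    finrank F ↥(liftL A ⊓ liftL B) + (A - B).rank ≤ n := by
  have h1 := finrank_ker_vecMul (A - B)
  have h2 := finrank_eq_fst_add (liftL A ⊓ liftL B)
  have h3 : liftL A ⊓ liftL B ⊓ spaceS F n = ⊥ := by
    rw [eq_bot_iff, ← liftL_inf_spaceS A]
    exact inf_le_inf_right _ inf_le_left
  rw [h3, finrank_bot, add_zero] at h2
  have h4 : (liftL A ⊓ liftL B).map (LinearMap.fst F (Fin n → F) (Fin n → F))
      ≤ LinearMap.ker (A - B).vecMulLinear := by
    rintro _ ⟨v, ⟨hA, hB⟩, rfl⟩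
    rw [LinearMap.mem_ker, vecMulLinear_apply, vecMul_sub, sub_eq_zero]
    exact (mem_liftL.1 hA).symm.trans (mem_liftL.1 hB)
  have h5 := Submodule.finrank_mono h4
  omega

theorem finrank_liftL'_inf_liftL'_add_rank_le (A B : Matrix (Fin n) (Fin n) F) :
    finrank F ↥(liftL' A ⊓ liftL' B) + (A - B).rank ≤ n := by
  have h1 := finrank_ker_vecMul (A - B)
  have h2 := finrank_eq_snd_add (liftL' A ⊓ liftL' B)
  have h3 : liftL' A ⊓ liftL' B ⊓ spaceS' F n = ⊥ := by
    rw [eq_bot_iff, ← liftL'_inf_spaceS' A]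
    exact inf_le_inf_right _ inf_le_left
  rw [h3, finrank_bot, add_zero] at h2
  have h4 : (liftL' A ⊓ liftL' B).map (LinearMap.snd F (Fin n → F) (Fin n → F))
      ≤ LinearMap.ker (A - B).vecMulLinear := by
    rintro _ ⟨v, ⟨hA, hB⟩, rfl⟩
    rw [LinearMap.mem_ker, vecMulLinear_apply, vecMul_sub, sub_eq_zero]
    exact (mem_liftL'.1 hA).symm.trans (mem_liftL'.1 hB)
  have h5 := Submodule.finrank_mono h4
  omega

/-- A quadratic form that vanishes on a hyperplane is a product of two linear forms; hence its
matrix differs from an alternating matrix by a matrix of rank at most one. -/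
theorem exists_isSkew_sub_vecMulVec {A : Matrix (Fin n) (Fin n) F} {W : Submodule F (Fin n → F)}
    (hW : n - 1 ≤ finrank F W) (h : ∀ x ∈ W, x ⬝ᵥ A *ᵥ x = 0) :
    ∃ l m : Fin n → F, IsSkew (A - vecMulVec l m) := by
  rcases eq_or_ne W ⊤ with rfl | hne
  · refine ⟨0, 0, ?_⟩
    rw [zero_vecMulVec, sub_zero, isSkew_iff_forall]
    exact fun x => h x trivial
  obtain ⟨f, hf, hle⟩ := Submodule.exists_le_ker_of_lt_top W (lt_top_iff_ne_top.2 hne)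
  have hker : LinearMap.ker f = W := by
    refine (Submodule.eq_of_le_of_finrank_le hle ?_).symm
    have h1 : finrank F (LinearMap.ker f) < finrank F (Fin n → F) :=
      Submodule.finrank_lt (mt LinearMap.ker_eq_top.1 hf)
    rw [finrank_fin_fun] at h1
    omega
  obtain ⟨u, hu⟩ : ∃ u, f u = 1 := LinearMap.surjective hf 1
  set l : Fin n → F := fun i => f (Pi.single i 1) with hl
  have hfl : ∀ x, f x = x ⬝ᵥ l := by
    intro x
    conv_lhs => rw [pi_eq_sum_univ' x]
    rw [map_sum]
    simp [dotProduct, hl]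
  refine ⟨l, A *ᵥ u + u ᵥ* A - (u ⬝ᵥ A *ᵥ u) • l, ?_⟩
  rw [isSkew_iff_forall]
  intro x
  have hx : x - f x • u ∈ W := by
    rw [← hker, LinearMap.mem_ker, map_sub, map_smul, hu]
    simp
  have h1 := h _ hx
  simp only [mulVec_sub, mulVec_smul, dotProduct_sub, sub_dotProduct, smul_dotProduct,
    dotProduct_smul, smul_eq_mul] at h1
  have h2 : x ⬝ᵥ u ᵥ* A = u ⬝ᵥ A *ᵥ x := by rw [dotProduct_mulVec, dotProduct_comm]
  rw [sub_mulVec, vecMulVec_mulVec, dotProduct_sub, op_smul_eq_smul, dotProduct_smul, ← hfl,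
    dotProduct_comm _ x, dotProduct_sub, dotProduct_add, h2, dotProduct_smul, ← hfl]
  simp only [smul_eq_mul]
  linear_combination h1

/-- If `L(A)` has a totally singular hyperplane, then `A` is alternating. -/
theorem isSkew_of_finrank_liftL_inf {M : Submodule F (Matrix (Fin n) (Fin n) F)}
    (hM : ∀ A ∈ M, A ≠ 0 → 2 ≤ A.rank) (hsk : ∀ A, IsSkew A → A ∈ M)
    {A : Matrix (Fin n) (Fin n) F} (hA : A ∈ M) {U : Submodule F (Ambient F n)}
    (hU : ∀ v ∈ U, hyperbolicForm F n v = 0) (hd : n - 1 ≤ finrank F ↥(liftL A ⊓ U)) :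
    IsSkew A := by
  rw [finrank_eq_fst_add] at hd
  have h3 : liftL A ⊓ U ⊓ spaceS F n = ⊥ := by
    rw [eq_bot_iff, ← liftL_inf_spaceS A]
    exact inf_le_inf_right _ inf_le_left
  rw [h3, finrank_bot, add_zero] at hd
  obtain ⟨l, m, h⟩ := exists_isSkew_sub_vecMulVec (A := A) hd (by
    rintro _ ⟨v, ⟨h1, h2⟩, rfl⟩
    have h3 := hU v h2
    rw [hyperbolicForm_eq, mem_liftL.1 h1, dotProduct_comm, ← dotProduct_mulVec] at h3
    exact h3)
  have h0 : vecMulVec l m = 0 := by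
    by_contra hne
    have h1 := hM _ (by simpa using M.sub_mem hA (hsk _ h)) hne
    have h2 := rank_vecMulVec_le l m
    omega
  rwa [h0, sub_zero] at h

theorem finrank_dotOrth_inf_eq {l m : Submodule F (Fin n → F)} (hl : finrank F l = 2)
    (hm : finrank F m = 2) (h : Disjoint l m) :
    finrank F ↥(dotOrth l ⊓ dotOrth m) + 4 = n := by
  have h1 := finrank_dotOrth_add (l ⊔ m)
  have h2 := Submodule.finrank_sup_add_finrank_inf_eq l m
  rw [disjoint_iff.1 h, finrank_bot, hl, hm] at h2
  rw [dotOrth_sup] at h1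
  omega

/-- A totally singular subspace `T` of `m ^ ⊥ × l` has dimension at most `n - 2`: if
`T ∩ S = 0 × Z` then the projection of `T` is orthogonal to `m ⊕ Z`. -/
theorem finrank_prod_inf_le {l m : Submodule F (Fin n → F)} (hm : finrank F m = 2)
    (h : Disjoint l m) {U : Submodule F (Ambient F n)}
    (hU : ∀ v ∈ U, hyperbolicForm F n v = 0) :
    finrank F ↥(Submodule.prod (dotOrth m) l ⊓ U) + 2 ≤ n := by
  set T : Submodule F (Ambient F n) := Submodule.prod (dotOrth m) l ⊓ U with hT
  set Z : Submodule F (Fin n → F) := T.comap (LinearMap.inr F (Fin n → F) (Fin n → F)) with hZ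
  have h1 : T ⊓ spaceS F n = Submodule.prod ⊥ Z := by
    ext ⟨x, y⟩
    rw [Submodule.mem_inf, mem_spaceS, Submodule.mem_prod, Submodule.mem_bot, hZ,
      Submodule.mem_comap, and_comm]
    refine and_congr_right fun h0 => ?_
    rw [show x = 0 from h0]
    rfl
  have hZl : Z ≤ l := fun y hy => hy.1.2
  have h2 : fstProj T ≤ dotOrth (m ⊔ Z) := by
    rw [dotOrth_sup, le_inf_iff]
    constructor
    · rintro _ ⟨v, hv, rfl⟩
      exact hv.1.1
    · rintro _ ⟨v, hv, rfl⟩ y hy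
      have := dotProduct_add_eq_zero_of_mem hU hv.2 hy.2
      simpa [dotProduct_comm] using this
  have h3 := Submodule.finrank_mono h2
  have h4 := finrank_dotOrth_add (m ⊔ Z)
  have h5 := Submodule.finrank_sup_add_finrank_inf_eq m Z
  rw [disjoint_iff.1 (h.symm.mono_right hZl), finrank_bot, hm] at h5
  have h6 : finrank F T = finrank F (fstProj T) + finrank F Z := by
    rw [finrank_eq_fst_add, h1, finrank_submodule_prod, finrank_bot, zero_add, ← fstProj]
  have h7 : finrank F T + 2 ≤ n := by omega
  exact h7

variable [Finite F]

/-- Distinct generators in the same system do not meet in a hyperplane of both. -/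
theorem IsGenerator.finrank_inf_add_two_le {U U' : Submodule F (Ambient F n)}
    (hU : IsGenerator U) (hU' : IsGenerator U') (he : Even (finrank F (fstProj U)))
    (he' : Even (finrank F (fstProj U'))) (hne : U ≠ U') : finrank F ↥(U ⊓ U') + 2 ≤ n := by
  have h1 := finrank_eq_fst_add (U ⊓ U')
  have h2 : U ⊓ U' ⊓ spaceS F n = Submodule.prod ⊥ (dotOrth (fstProj U ⊔ fstProj U')) := by
    rw [inf_inf_distrib_right, hU.inf_spaceS, hU'.inf_spaceS, Submodule.prod_inf_prod, dotOrth_sup,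
      inf_idem]
  rw [h2, finrank_submodule_prod, finrank_bot, zero_add] at h1
  have h3 := finrank_dotOrth_add (fstProj U ⊔ fstProj U')
  by_cases hW : fstProj U = fstProj U'
  · -- The two alternating forms on the common projection differ, by a form of rank at least two.
    obtain ⟨P, Q, hPQ, hP⟩ := exists_rowBasis (fstProj U)
    obtain ⟨B, hB, hBU⟩ := hU.exists_eq_genOf hPQ hP
    obtain ⟨B', hB', hBU'⟩ := hU'.exists_eq_genOf hPQ (by rwa [← hW])
    have h4 : (U ⊓ U').map (LinearMap.fst F (Fin n → F) (Fin n → F))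
        ≤ (LinearMap.ker (B - B').vecMulLinear).map P.vecMulLinear := by
      rintro _ ⟨v, ⟨hv, hv'⟩, rfl⟩
      rw [← hBU] at hv
      rw [← hBU'] at hv'
      obtain ⟨c, hc1, hc2⟩ := (mem_genOf hPQ).1 hv
      obtain ⟨d, hd1, hd2⟩ := (mem_genOf hPQ).1 hv'
      have hdc : c = d := vecMul_right_injective hPQ (hc1.trans hd1.symm)
      subst hdc
      refine ⟨c, ?_, hc1⟩
      rw [SetLike.mem_coe, LinearMap.mem_ker, vecMulLinear_apply, vecMul_sub, ← hc2, ← hd2,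
        sub_self]
    have h5 := Submodule.finrank_mono h4
    have h6 := Submodule.finrank_map_le P.vecMulLinear (LinearMap.ker (B - B').vecMulLinear)
    have h7 := finrank_ker_vecMul (B - B')
    have h8 : (B - B').rank ≠ 0 := by
      rw [← finrank_rowSpace, Ne, Submodule.finrank_eq_zero, rowSpace, Submodule.span_eq_bot]
      intro h
      have h9 : B = B' := by
        funext i
        exact sub_eq_zero.1 (h _ ⟨i, rfl⟩)
      exact hne (by rw [← hBU, ← hBU', h9])
    obtain ⟨t, ht⟩ := (hB.sub hB').even_rank
    rw [← hW, sup_idem] at h3 h1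
    omega
  · have h4 : (U ⊓ U').map (LinearMap.fst F (Fin n → F) (Fin n → F))
        ≤ fstProj U ⊓ fstProj U' :=
      le_inf (Submodule.map_mono inf_le_left) (Submodule.map_mono inf_le_right)
    have h5 := Submodule.finrank_mono h4
    have h6 := Submodule.finrank_sup_add_finrank_inf_eq (fstProj U) (fstProj U')
    have h7 : finrank F ↥(fstProj U ⊓ fstProj U') < finrank F ↥(fstProj U ⊔ fstProj U') := by
      refine Submodule.finrank_lt_finrank_of_lt (lt_of_le_of_ne (inf_le_left.trans le_sup_left) ?_)
      intro h
      exact hW (inf_eq_sup.1 h)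
    obtain ⟨s, hs⟩ := he
    obtain ⟨t, ht⟩ := he'
    omega

/-- By parity, a generator in the system of `S` never meets `S'` in just a point. -/
theorem two_le_finrank_inf_spaceS'_or {U : Submodule F (Ambient F n)}
    (hU : U ∈ generatorPart F n) :
    2 ≤ finrank F ↥(U ⊓ spaceS' F n) ∨ ∃ A, IsSkew A ∧ A.rank + 1 = n ∧ liftL' A = U := by
  obtain ⟨hg, hs, h⟩ := hU
  by_cases h0 : U ⊓ spaceS' F n = ⊥
  · right
    obtain ⟨A, hA, rfl⟩ := isGenerator_and_inf_spaceS'_eq_bot_iff.1 ⟨hg, h0⟩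
    have h1 := finrank_liftL'_inf_spaceS A
    exact ⟨A, hA, by have := h.resolve_right (fun h => h.2 h0); omega, rfl⟩
  · left
    obtain ⟨t, ht⟩ := hg.even_finrank_inf_spaceS' (hg.sameSystem_spaceS_iff.1 hs)
    have := mt (Submodule.finrank_eq_zero (R := F) (S := U ⊓ spaceS' F n)).1 h0
    omega

end Intersections

/-! ### Partial line spreads -/

section Spreads

variable {F : Type*} [Field F]

theorem IsPartialLineSpread.map {V V' : Type*} [AddCommGroup V] [Module F V] [AddCommGroup V']
    [Module F V'] {W : Submodule F V} {P : Set (Submodule F V)} (h : IsPartialLineSpread W P)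
    {f : V →ₗ[F] V'} (hf : Function.Injective f) :
    IsPartialLineSpread (W.map f) (Submodule.map f '' P) := by
  constructor
  · rintro _ ⟨l, hl, rfl⟩
    exact ⟨Submodule.map_mono (h.1 l hl).1,
      (Submodule.equivMapOfInjective f hf l).finrank_eq.symm.trans (h.1 l hl).2⟩
  · rintro _ ⟨l, hl, rfl⟩ _ ⟨m, hm, rfl⟩ hne
    rw [disjoint_iff, ← Submodule.map_inf f hf,
      disjoint_iff.1 (h.2 hl hm fun e => hne (by rw [e])), Submodule.map_bot]

theorem ncard_image_map {V V' : Type*} [AddCommGroup V] [Module F V] [AddCommGroup V']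
    [Module F V'] (P : Set (Submodule F V)) {f : V →ₗ[F] V'} (hf : Function.Injective f) :
    (Submodule.map f '' P).ncard = P.ncard :=
  Set.ncard_image_of_injective _ (Submodule.map_injective_of_injective hf)

theorem exists_injective_prod_self (V : Type*) [AddCommGroup V] [Module F V]
    [FiniteDimensional F V] (h : 2 ≤ finrank F V) :
    ∃ f : F × F →ₗ[F] V, Function.Injective f := by
  let b := finBasis F V
  let i : Fin 2 → Fin (finrank F V) := Fin.castLE h
  have hb : LinearIndependent F (b ∘ i) := b.linearIndependent.comp i (Fin.castLE_injective h)
  refine ⟨(Fintype.linearCombination F (b ∘ i)) ∘ₗ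
    (LinearEquiv.finTwoArrow F F).symm.toLinearMap, ?_⟩
  have hinj : Function.Injective (Fintype.linearCombination F (b ∘ i)) :=
    (injective_iff_map_eq_zero _).2 fun c hc => funext (Fintype.linearIndependent_iff.1 hb c hc)
  exact hinj.comp (LinearEquiv.injective _)

theorem isPartialLineSpread_top_iff {V : Type*} [AddCommGroup V] [Module F V]
    {P : Set (Submodule F V)} : IsPartialLineSpread ⊤ P ↔
      (∀ l ∈ P, finrank F l = 2) ∧ P.Pairwise Disjoint := by
  simp [IsPartialLineSpread]

theorem disjoint_lines_ne {V : Type*} [AddCommGroup V] [Module F V] {l m : Submodule F V}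
    (hl : finrank F l = 2) (h : Disjoint l m) : l ≠ m := by
  rintro rfl
  rw [disjoint_self.1 h, finrank_bot] at hl
  omega

/-- The graphs of the maps `v ↦ φ v * x`, for `x` in an extension field `E` of degree `n` and an
injective linear map `φ : F × F → E`, together with the lines of a partial line spread
of `E`, form a partial line spread of `(F × F) × E`. -/
theorem exists_isPartialLineSpread [Finite F] (m : ℕ) :
    ∃ P : Set (Submodule F (Fin (2 * m + 3) → F)),
      IsPartialLineSpread ⊤ P ∧ P.ncard = spreadSize (Nat.card F) (2 * m + 3) := by
  induction m with
  | zero =>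
    obtain ⟨f, hf⟩ := exists_injective_prod_self (F := F) (Fin (2 * 0 + 3) → F) (by simp)
    refine ⟨{LinearMap.range f}, ?_, by simp [spreadSize]⟩
    rw [isPartialLineSpread_top_iff]
    refine ⟨?_, Set.pairwise_singleton _ _⟩
    rintro _ rfl
    rw [LinearMap.finrank_range_of_inj hf]
    simp
  | succ m ih =>
    obtain ⟨P, hP, hcard⟩ := ih
    obtain ⟨E, _, _, ⟨b⟩⟩ := exists_field_extension_basis F (show 2 * m + 3 ≠ 0 by omega)
    have : FiniteDimensional F E := b.finiteDimensional_of_finite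
    have hE : finrank F E = 2 * m + 3 := by rw [finrank_eq_card_basis b, Fintype.card_fin]
    obtain ⟨φ, hφ⟩ := exists_injective_prod_self (F := F) E (by omega)
    let g : E → Submodule F ((F × F) × E) := fun x => (LinearMap.mulRight F x ∘ₗ φ).graph
    have mem_g : ∀ x v, v ∈ g x ↔ v.2 = φ v.1 * x := fun x v => LinearMap.mem_graph_iff (LinearMap.mulRight F x ∘ₗ φ) v
    have hg2 : ∀ x, finrank F (g x) = 2 := by
      intro x
      have hi : Function.Injective
          ((LinearMap.id : F × F →ₗ[F] F × F).prod (LinearMap.mulRight F x ∘ₗ φ)) :=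
        fun v w h => congrArg Prod.fst h
      rw [show g x = _ from LinearMap.graph_eq_range_prod _, LinearMap.finrank_range_of_inj hi]
      simp
    have hgd : ∀ x y, x ≠ y → Disjoint (g x) (g y) := by
      intro x y hne
      rw [Submodule.disjoint_def]
      intro v hx hy
      rw [mem_g] at hx hy
      have h1 : φ v.1 * (x - y) = 0 := by rw [mul_sub, ← hx, ← hy, sub_self]
      have h2 : φ v.1 = 0 := (mul_eq_zero.1 h1).resolve_right (sub_ne_zero.2 hne)
      rw [h2, zero_mul] at hx
      exact Prod.ext (hφ (by rw [h2, Prod.fst_zero, map_zero])) hx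
    have hginj : Function.Injective g := by
      intro x y h
      by_contra hne
      exact disjoint_lines_ne (hg2 x) (hgd x y hne) h
    let f : (Fin (2 * m + 3) → F) →ₗ[F] (F × F) × E :=
      LinearMap.inr F (F × F) E ∘ₗ b.equivFun.symm.toLinearMap
    have hf : Function.Injective f := LinearMap.inr_injective.comp (LinearEquiv.injective _)
    have hP' := hP.map hf
    have hgf : ∀ x, ∀ l ∈ Submodule.map f '' P, Disjoint (g x) l := by
      rintro x _ ⟨l, hl, rfl⟩
      rw [Submodule.disjoint_def]
      rintro v hx ⟨w, -, rfl⟩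
      rw [mem_g] at hx
      have h1 : (f w).1 = 0 := rfl
      rw [h1, map_zero, zero_mul] at hx
      exact Prod.ext h1 hx
    have hunion : IsPartialLineSpread ⊤ (Set.range g ∪ Submodule.map f '' P) := by
      rw [isPartialLineSpread_top_iff]
      constructor
      · rintro l (⟨x, rfl⟩ | hl)
        · exact hg2 x
        · exact (hP'.1 l hl).2
      · rintro l (⟨x, rfl⟩ | hl) k (⟨y, rfl⟩ | hk) hne
        · exact hgd x y fun h => hne (by rw [h])
        · exact hgf x k hk
        · exact (hgf y l hl).symm
        · exact hP'.2 hl hk hne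
    have hfin := finite_submodule F ((F × F) × E)
    have hdisj : Disjoint (Set.range g) (Submodule.map f '' P) := by
      rw [Set.disjoint_left]
      rintro _ ⟨x, rfl⟩ hl
      exact disjoint_lines_ne (hg2 x) (hgf x _ hl) rfl
    have hsize : (Set.range g ∪ Submodule.map f '' P).ncard
        = spreadSize (Nat.card F) (2 * (m + 1) + 3) := by
      rw [Set.ncard_union_eq hdisj, ncard_image_map P hf, hcard, ← Set.image_univ,
        Set.ncard_image_of_injective _ hginj, Set.ncard_univ,
        Module.natCard_eq_pow_finrank (K := F), hE, spreadSize, spreadSize,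
        show (2 * (m + 1) + 3 - 3) / 2 = m + 1 by omega, show (2 * m + 3 - 3) / 2 = m by omega,
        Finset.sum_Icc_succ_top (by omega)]
      ring
    let e : ((F × F) × E) ≃ₗ[F] (Fin (2 * (m + 1) + 3) → F) :=
      LinearEquiv.ofFinrankEq _ _ (by simp [hE]; ring)
    refine ⟨Submodule.map e.toLinearMap '' (Set.range g ∪ Submodule.map f '' P), ?_, ?_⟩
    · have := hunion.map (f := e.toLinearMap) e.injective
      rwa [Submodule.map_top, LinearEquiv.range] at this
    · rw [ncard_image_map _ (f := e.toLinearMap) e.injective, hsize]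

open Classical in
theorem card_filter_mem_ne_zero [Finite F] {V : Type*} [AddCommGroup V] [Module F V] [Fintype V]
    (N : Submodule F V) :
    ((Finset.univ.filter fun v => v ∈ N ∧ v ≠ 0).card : ℤ) = (Nat.card F : ℤ) ^ finrank F N - 1 := by
  have h1 : (Finset.univ.filter fun v => v ∈ N).card = Nat.card F ^ finrank F N := by
    have : Module.Finite F N := Module.Finite.of_finite
    rw [← Module.natCard_eq_pow_finrank, ← Fintype.card_subtype, ← Nat.card_eq_fintype_card]
  have h2 : (Finset.univ.filter fun v => v ∈ N ∧ v ≠ 0)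
      = (Finset.univ.filter fun v => v ∈ N).erase 0 := by
    ext v
    simp [and_comm]
  rw [h2, Finset.card_erase_of_mem (by simp), h1, Nat.cast_sub (Nat.one_le_pow _ _ Nat.card_pos)]
  push_cast
  ring

open Classical in
/-- The holes in `K` of a set of subspaces: the non-zero vectors of `K` in no member of the set. -/
noncomputable def holes {V : Type*} [AddCommGroup V] [Module F V] [Fintype V]
    (P : Finset (Submodule F V)) (K : Submodule F V) : Finset V :=
  Finset.univ.filter fun v => v ∈ K ∧ v ≠ 0 ∧ ∀ l ∈ P, v ∉ l

theorem mem_holes {V : Type*} [AddCommGroup V] [Module F V] [Fintype V]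
    {P : Finset (Submodule F V)} {K : Submodule F V} {v : V} :
    v ∈ holes P K ↔ v ∈ K ∧ v ≠ 0 ∧ ∀ l ∈ P, v ∉ l := by
  simp [holes]

variable [Finite F]

/-- The non-zero vectors of `K` are those on no line (the holes), and those on exactly one. -/
theorem card_holes_add {V : Type*} [AddCommGroup V] [Module F V] [Fintype V]
    {P : Finset (Submodule F V)} (hP : (P : Set (Submodule F V)).Pairwise Disjoint)
    (K : Submodule F V) :
    ((holes P K).card : ℤ)
      + ∑ l ∈ P, ((Nat.card F : ℤ) ^ finrank F ↥(l ⊓ K) - 1)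
      = (Nat.card F : ℤ) ^ finrank F K - 1 := by
  classical
  rw [← card_filter_mem_ne_zero, Finset.sum_congr rfl fun l _ =>
    (card_filter_mem_ne_zero (F := F) (l ⊓ K)).symm]
  have h1 : (Finset.univ.filter fun v => v ∈ K ∧ v ≠ 0)
      = holes P K ∪
        P.biUnion fun l => Finset.univ.filter fun v => v ∈ l ⊓ K ∧ v ≠ 0 := by
    ext v
    simp only [Finset.mem_filter, Finset.mem_univ, true_and, Finset.mem_union, mem_holes,
      Finset.mem_biUnion, Submodule.mem_inf]
    by_cases h : ∃ l ∈ P, v ∈ l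
    · constructor
      · rintro ⟨hK, h0⟩
        obtain ⟨l, hl, hv⟩ := h
        exact Or.inr ⟨l, hl, ⟨hv, hK⟩, h0⟩
      · rintro (h | ⟨l, hl, ⟨hv, hK⟩, h0⟩)
        · exact ⟨h.1, h.2.1⟩
        · exact ⟨hK, h0⟩
    · push Not at h
      constructor
      · rintro ⟨hK, h0⟩
        exact Or.inl ⟨hK, h0, h⟩
      · rintro (h | ⟨l, hl, ⟨hv, hK⟩, h0⟩)
        · exact ⟨h.1, h.2.1⟩
        · exact ⟨hK, h0⟩
  rw [h1, Finset.card_union_of_disjoint, Finset.card_biUnion]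
  · push_cast
    rfl
  · intro l hl m hm hne
    refine Finset.disjoint_left.2 fun v hv hv' => ?_
    simp only [Finset.mem_filter, Finset.mem_univ, true_and, Submodule.mem_inf] at hv hv'
    exact hv.2 (Submodule.disjoint_def.1 (hP hl hm hne) v hv.1.1 hv'.1.1)
  · rw [Finset.disjoint_left]
    intro v hv hv'
    simp only [Finset.mem_filter, Finset.mem_univ, true_and, Finset.mem_biUnion, mem_holes,
      Submodule.mem_inf] at hv hv'
    obtain ⟨l, hl, h2⟩ := hv'
    exact hv.2.2 l hl h2.1.1

theorem spreadSize_mul (q m : ℕ) :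
    (spreadSize q (2 * m + 3) : ℤ) * ((q : ℤ) ^ 2 - 1)
      = (q : ℤ) ^ (2 * m + 3) - (q : ℤ) ^ 3 + (q : ℤ) ^ 2 - 1 := by
  rw [spreadSize, show (2 * m + 3 - 3) / 2 = m by omega]
  induction m with
  | zero => simp
  | succ m ih =>
    rw [Finset.sum_Icc_succ_top (by omega)]
    push_cast at ih ⊢
    linear_combination ih

theorem dvd_spreadSize_sub_one (q n : ℕ) : (q : ℤ) ∣ (spreadSize q n : ℤ) - 1 := by
  rw [spreadSize]
  push_cast
  rw [add_sub_cancel_left]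
  exact Finset.dvd_sum fun i _ => dvd_pow_self _ (by omega)

/-- With one line more than `spreadSize`, every hyperplane contains at least `q - 1` points, that is
`(q - 1) ^ 2` non-zero vectors, on no line: their number is `-1` modulo `q` and non-negative. -/
theorem sq_le_card_holes_hyperplane {n m : ℕ} (hn : n = 2 * m + 3)
    {P : Finset (Submodule F (Fin n → F))} (hP2 : ∀ l ∈ P, finrank F l = 2)
    (hP : (P : Set (Submodule F (Fin n → F))).Pairwise Disjoint)
    (hcard : P.card = spreadSize (Nat.card F) n + 1)
    [Fintype (Fin n → F)] {K : Submodule F (Fin n → F)} (hK : finrank F K + 1 = n) :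
    ((Nat.card F : ℤ) - 1) ^ 2
      ≤ (holes P K).card := by
  classical
  have h1 := card_holes_add hP K
  set N : ℤ := ((holes P K).card : ℤ) with hN
  have hN0 : 0 ≤ N := Nat.cast_nonneg _
  have hq : 2 ≤ Nat.card F := Finite.one_lt_card
  set q := Nat.card F with hqdef
  have hl : ∀ l ∈ P, (q : ℤ) ^ finrank F ↥(l ⊓ K) - 1
      = ((q : ℤ) - 1) + if l ≤ K then (q : ℤ) * (q - 1) else 0 := by
    intro l hl
    split_ifs with h
    · rw [inf_eq_left.2 h, hP2 l hl]
      ring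
    · have h2 := Submodule.finrank_sup_add_finrank_inf_eq l K
      have h3 := Submodule.finrank_le (l ⊔ K)
      have h4 : finrank F ↥(l ⊓ K) < finrank F l :=
        Submodule.finrank_lt_finrank_of_lt (inf_lt_left.2 h)
      rw [finrank_fin_fun] at h3
      rw [hP2 l hl] at h2 h4
      rw [show finrank F ↥(l ⊓ K) = 1 by omega]
      ring
  rw [Finset.sum_congr rfl hl, Finset.sum_add_distrib, Finset.sum_const, ← Finset.sum_filter,
    Finset.sum_const, hcard] at h1
  set a := (P.filter (· ≤ K)).card
  obtain ⟨d, hd⟩ := dvd_spreadSize_sub_one q n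
  have hd' : (spreadSize q n : ℤ) = 1 + q * d := by linarith
  obtain ⟨c, hc⟩ : ((q : ℤ) - 1) ∣ (q : ℤ) ^ (finrank F K - 1) - 1 := sub_one_dvd_pow_sub_one _ _
  have hc' : (q : ℤ) ^ finrank F K = q * (1 + (q - 1) * c) := by
    rw [← hc, show finrank F K = finrank F K - 1 + 1 by omega, pow_succ, Nat.add_sub_cancel]
    ring
  rw [hc'] at h1
  simp only [nsmul_eq_mul, Nat.cast_add, Nat.cast_one, hd'] at h1
  -- The number of holes is `-1` modulo `q`, up to the factor `q - 1`.
  have h2 : N = ((q : ℤ) - 1) * (q * (c - d - a) - 1) := by linear_combination h1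
  have hq' : (2 : ℤ) ≤ q := by exact_mod_cast hq
  have h3 : 1 ≤ c - d - a := by
    by_contra hlt
    have h4 : (q : ℤ) * (c - d - a) ≤ 0 :=
      mul_nonpos_of_nonneg_of_nonpos (by linarith) (by omega)
    nlinarith
  have h4 : (q : ℤ) * 1 ≤ q * (c - d - a) := mul_le_mul_of_nonneg_left h3 (by linarith)
  rw [h2, sq]
  exact mul_le_mul_of_nonneg_left (by linarith) (by linarith)

/-- Beutelspacher's bound.  If there were one more line, the holes would be too few for the number of
them that each hyperplane must contain. -/
theorem ncard_le_spreadSize {n m : ℕ} (hn : n = 2 * m + 3) {P : Set (Submodule F (Fin n → F))}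
    (hP : IsPartialLineSpread ⊤ P) : P.ncard ≤ spreadSize (Nat.card F) n := by
  classical
  by_contra! hlt
  rw [isPartialLineSpread_top_iff] at hP
  have hfin := finite_submodule F (Fin n → F)
  have := finite_of_finiteDimensional F (Fin n → F)
  have := Fintype.ofFinite (Fin n → F)
  obtain ⟨P₁, hP₁, hcard⟩ := Set.exists_subset_card_eq (Nat.succ_le_of_lt hlt)
  obtain ⟨P', rfl⟩ := (Set.toFinite P₁).exists_finset_coe
  rw [Set.ncard_coe_finset] at hcard
  have h2 : ∀ l ∈ P', finrank F l = 2 := fun l hl => hP.1 l (hP₁ hl)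
  have hd := hP.2.mono hP₁
  have hq : 2 ≤ Nat.card F := Finite.one_lt_card
  have hq' : (2 : ℤ) ≤ Nat.card F := by exact_mod_cast hq
  have hall := card_holes_add hd ⊤
  set H := holes P' (⊤ : Submodule F (Fin n → F)) with hH
  have hyp : ∀ w : Fin n → F, w ≠ 0 → finrank F (dotOrth (F ∙ w)) + 1 = n := by
    intro w hw
    rw [← finrank_span_singleton (K := F) hw]
    exact finrank_dotOrth_add _
  have hmem : ∀ v w : Fin n → F, v ∈ dotOrth (F ∙ w) ↔ w ⬝ᵥ v = 0 := by
    intro v w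
    rw [mem_dotOrth]
    refine ⟨fun h => h w (Submodule.mem_span_singleton_self w), fun h x hx => ?_⟩
    obtain ⟨c, rfl⟩ := Submodule.mem_span_singleton.1 hx
    rw [smul_dotProduct, h, smul_zero]
  -- Double counting of the pairs of a hole and a hyperplane on it.
  have hdc := Finset.sum_card_bipartiteAbove_eq_sum_card_bipartiteBelow
    (s := Finset.univ.filter fun w : Fin n → F => w ≠ 0) (t := H) (fun w v => w ⬝ᵥ v = 0)
  set q := Nat.card F with hqdef
  have hlow : ∀ w ∈ Finset.univ.filter fun w : Fin n → F => w ≠ 0,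
      ((q : ℤ) - 1) ^ 2 ≤ (H.bipartiteAbove (fun w v => w ⬝ᵥ v = 0) w).card := by
    intro w hw
    refine (sq_le_card_holes_hyperplane hn h2 hd hcard
      (hyp w (Finset.mem_filter.1 hw).2)).trans_eq ?_
    congr 2
    ext v
    simp only [Finset.mem_filter, true_and, hmem, Finset.bipartiteAbove, hH,
      mem_holes, Submodule.mem_top]
    exact and_comm
  have hup : ∀ v ∈ H, ((Finset.bipartiteBelow (fun w v => w ⬝ᵥ v = 0)
      (Finset.univ.filter fun w : Fin n → F => w ≠ 0) v).card : ℤ) = (q : ℤ) ^ (n - 1) - 1 := by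
    intro v hv
    have hv0 : v ≠ 0 := (mem_holes.1 hv).2.1
    have h3 := card_filter_mem_ne_zero (dotOrth (F ∙ v))
    have h4 := hyp v hv0
    rw [show finrank F (dotOrth (F ∙ v)) = n - 1 by omega] at h3
    rw [← h3]
    congr 2
    ext w
    simp only [Finset.mem_filter, Finset.mem_univ, true_and, hmem, Finset.bipartiteBelow]
    rw [dotProduct_comm, and_comm]
  have h5 := Finset.sum_le_sum hlow
  rw [← Nat.cast_sum, hdc, Nat.cast_sum, Finset.sum_congr rfl hup, Finset.sum_const,
    Finset.sum_const] at h5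
  have h6 := card_filter_mem_ne_zero (F := F) (⊤ : Submodule F (Fin n → F))
  simp only [Submodule.mem_top, true_and, finrank_top, finrank_fin_fun] at h6
  simp only [nsmul_eq_mul] at h5
  rw [h6, ← hqdef] at h5
  have h7 : ∀ l ∈ P', (q : ℤ) ^ finrank F ↥(l ⊓ (⊤ : Submodule F (Fin n → F))) - 1
      = (q : ℤ) ^ 2 - 1 := fun l hl => by rw [inf_top_eq, h2 l hl]
  rw [Finset.sum_congr rfl h7, Finset.sum_const, hcard, finrank_top, finrank_fin_fun,
    nsmul_eq_mul] at hall
  have h8 := spreadSize_mul q m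
  rw [← hn] at h8
  push_cast at hall
  have h9 : (H.card : ℤ) = (q - 1) * ((q : ℤ) ^ 2 - q - 1) := by linear_combination hall - h8
  have h10 : (q : ℤ) ^ n = q * (q : ℤ) ^ (n - 1) := by
    rw [← pow_succ']
    congr 1
    omega
  have h11 : (q : ℤ) ^ 2 ≤ (q : ℤ) ^ (n - 1) := pow_le_pow_right₀ (by linarith) (by omega)
  rw [h9, h10] at h5
  set Q : ℤ := (q : ℤ) ^ (n - 1)
  have h12 : (q * Q - 1) * ((q : ℤ) - 1) ≤ ((q : ℤ) ^ 2 - q - 1) * (Q - 1) := by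
    have hpos : (0 : ℤ) < q - 1 := by linarith
    refine le_of_mul_le_mul_left ?_ hpos
    linear_combination h5
  nlinarith

end Spreads

/-! ### The code -/

section Code

open Matrix

variable {F : Type*} [Field F] {n : ℕ}

theorem spaceS_eq_map_top :
    spaceS F n = Submodule.map (LinearMap.inr F (Fin n → F) (Fin n → F)) ⊤ := by
  rw [Submodule.map_inr, spaceS]

theorem exists_eq_image_map_inr {P : Set (Submodule F (Ambient F n))}
    (hP : IsPartialLineSpread (spaceS F n) P) :
    ∃ P₀ : Set (Submodule F (Fin n → F)), IsPartialLineSpread ⊤ P₀ ∧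
      P = Submodule.map (LinearMap.inr F (Fin n → F) (Fin n → F)) '' P₀ := by
  set f := LinearMap.inr F (Fin n → F) (Fin n → F)
  have hf : Function.Injective f := LinearMap.inr_injective
  have heq : P = Submodule.map f '' (Submodule.map f ⁻¹' P) := by
    refine (Set.image_preimage_eq_of_subset fun l hl => ⟨l.comap f, ?_⟩).symm
    refine Submodule.map_comap_eq_of_le ?_
    rw [LinearMap.range_eq_map, ← spaceS_eq_map_top]
    exact (hP.1 l hl).1
  refine ⟨Submodule.map f ⁻¹' P, ?_, heq⟩
  rw [isPartialLineSpread_top_iff]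
  refine ⟨fun l hl => ?_, fun l hl m hm hne => ?_⟩
  · exact (Submodule.equivMapOfInjective f hf l).finrank_eq.trans (hP.1 _ hl).2
  · have h := hP.2 hl hm ((Submodule.map_injective_of_injective hf).ne hne)
    rw [disjoint_iff, ← Submodule.map_inf f hf] at h
    rw [disjoint_iff]
    exact Submodule.map_injective_of_injective hf (h.trans (Submodule.map_bot f).symm)

/-- The extra space `⟨l, m ^ ⊥ ∩ S'⟩` is a product, since the polarity restricts to the dot product
between `S` and `S'`. -/
theorem map_inr_sup_perp_inf (l m : Submodule F (Fin n → F)) :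
    Submodule.map (LinearMap.inr F (Fin n → F) (Fin n → F)) l ⊔
      (perp (Submodule.map (LinearMap.inr F (Fin n → F) (Fin n → F)) m) ⊓ spaceS' F n)
      = Submodule.prod (dotOrth m) l := by
  have h : perp (Submodule.map (LinearMap.inr F (Fin n → F) (Fin n → F)) m) ⊓ spaceS' F n
      = Submodule.prod (dotOrth m) ⊥ := by
    ext v
    rw [Submodule.mem_inf, mem_spaceS', Submodule.mem_prod, Submodule.mem_bot, mem_perp,
      mem_dotOrth]
    refine and_congr_left fun _ => ?_
    constructor
    · intro h x hx
      have := h (0, x) ⟨x, hx, rfl⟩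
      rw [hyperbolicForm_polar, zero_dotProduct, zero_add, dotProduct_comm] at this
      exact this
    · rintro h _ ⟨x, hx, rfl⟩
      rw [hyperbolicForm_polar, dotProduct_comm v.1]
      simpa using h x hx
  rw [h, Submodule.map_inr, Submodule.prod_sup_prod, bot_sup_eq, sup_bot_eq]

theorem mem_extraPart {P : Set (Submodule F (Fin n → F))} {U : Submodule F (Ambient F n)} :
    U ∈ extraPart (Submodule.map (LinearMap.inr F (Fin n → F) (Fin n → F)) '' P) ↔
      ∃ l ∈ P, ∃ m ∈ P, l ≠ m ∧ Submodule.prod (dotOrth m) l = U := by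
  constructor
  · rintro ⟨_, ⟨l, hl, rfl⟩, _, ⟨m, hm, rfl⟩, hne, rfl⟩
    exact ⟨l, hl, m, hm, fun h => hne (by rw [h]), (map_inr_sup_perp_inf l m).symm⟩
  · rintro ⟨l, hl, m, hm, hne, rfl⟩
    exact ⟨_, ⟨l, hl, rfl⟩, _, ⟨m, hm, rfl⟩,
      (Submodule.map_injective_of_injective LinearMap.inr_injective).ne hne,
      map_inr_sup_perp_inf l m⟩

/-- The intersection has dimension at most `n - 2`.  For subspaces of dimension `n` this means that
their subspace distance is at least `4`. -/
def FarApart (U U' : Submodule F (Ambient F n)) : Prop :=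
  finrank F ↥(U ⊓ U') + 2 ≤ n

theorem FarApart.symm {U U' : Submodule F (Ambient F n)} (h : FarApart U U') : FarApart U' U := by
  rwa [FarApart, inf_comm]

theorem farApart_of_inf_eq_bot {U U' T : Submodule F (Ambient F n)} (hU : finrank F U = n)
    (h : U' ⊓ T = ⊥) (h2 : 2 ≤ finrank F ↥(U ⊓ T)) : FarApart U U' := by
  have := finrank_inf_add_inf_le U U' T h
  rw [FarApart]
  omega

theorem disjoint_of_farApart {C C' : Set (Submodule F (Ambient F n))}
    (hC : ∀ U ∈ C, finrank F U = n) (h : ∀ U ∈ C, ∀ U' ∈ C', FarApart U U') : Disjoint C C' := by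
  rw [Set.disjoint_left]
  intro U hU hU'
  have := h U hU U hU'
  rw [FarApart, inf_idem, hC U hU] at this
  omega

theorem pairwise_union_farApart {C C' : Set (Submodule F (Ambient F n))}
    (hC : C.Pairwise FarApart) (hC' : C'.Pairwise FarApart)
    (h : ∀ U ∈ C, ∀ U' ∈ C', FarApart U U') : (C ∪ C').Pairwise FarApart :=
  have : Std.Symm (FarApart (F := F) (n := n)) := ⟨fun _ _ h => h.symm⟩
  Set.pairwise_union_of_symm.2 ⟨hC, hC', fun U hU U' hU' _ => h U hU U' hU'⟩

section Extra

variable {P : Set (Submodule F (Fin n → F))}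

theorem finrank_of_mem_extraPart (hP : IsPartialLineSpread ⊤ P) {U : Submodule F (Ambient F n)}
    (hU : U ∈ extraPart (Submodule.map (LinearMap.inr F (Fin n → F) (Fin n → F)) '' P)) :
    finrank F U = n ∧ finrank F ↥(U ⊓ spaceS F n) = 2 ∧ finrank F ↥(U ⊓ spaceS' F n) + 2 = n := by
  obtain ⟨l, hl, m, hm, hne, rfl⟩ := mem_extraPart.1 hU
  have h1 := finrank_dotOrth_add m
  rw [isPartialLineSpread_top_iff] at hP
  rw [hP.1 m hm] at h1
  refine ⟨?_, ?_, ?_⟩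
  · rw [finrank_submodule_prod, hP.1 l hl, h1]
  · rw [spaceS, Submodule.prod_inf_prod, finrank_submodule_prod, inf_bot_eq, inf_top_eq,
      finrank_bot, hP.1 l hl]
  · rw [spaceS', Submodule.prod_inf_prod, finrank_submodule_prod, inf_bot_eq, inf_top_eq,
      finrank_bot, add_zero, h1]

theorem finrank_prod_dotOrth_inf (hP : IsPartialLineSpread ⊤ P)
    {l m m' : Submodule F (Fin n → F)} (hl : l ∈ P) (hm : m ∈ P) (hm' : m' ∈ P) (hne : m ≠ m') :
    finrank F ↥(Submodule.prod (dotOrth m) l ⊓ Submodule.prod (dotOrth m') l :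
      Submodule F (Ambient F n)) + 2 = n := by
  rw [isPartialLineSpread_top_iff] at hP
  have := finrank_dotOrth_inf_eq (hP.1 m hm) (hP.1 m' hm') (hP.2 hm hm' hne)
  rw [Submodule.prod_inf_prod, finrank_submodule_prod, inf_idem, hP.1 l hl]
  omega

theorem farApart_prod_dotOrth (hP : IsPartialLineSpread ⊤ P)
    {l m l' m' : Submodule F (Fin n → F)} (hl : l ∈ P) (hm : m ∈ P) (hl' : l' ∈ P) (hm' : m' ∈ P) (hne : (l, m) ≠ (l', m')) :
    FarApart (Submodule.prod (dotOrth m) l) (Submodule.prod (dotOrth m') l') := by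
  rcases eq_or_ne l l' with rfl | hll
  · exact (finrank_prod_dotOrth_inf hP hl hm hm' fun h => hne (by rw [h])).le
  · rw [isPartialLineSpread_top_iff] at hP
    have h1 := finrank_dotOrth_add m
    have h2 := Submodule.finrank_mono (inf_le_left : dotOrth m ⊓ dotOrth m' ≤ dotOrth m)
    rw [hP.1 m hm] at h1
    rw [FarApart, Submodule.prod_inf_prod, finrank_submodule_prod,
      disjoint_iff.1 (hP.2 hl hl' hll), finrank_bot]
    omega

theorem pairwise_farApart_extraPart (hP : IsPartialLineSpread ⊤ P) :
    (extraPart (Submodule.map (LinearMap.inr F (Fin n → F) (Fin n → F)) '' P)).Pairwise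
      FarApart := by
  intro U hU U' hU' hne
  obtain ⟨l, hl, m, hm, -, rfl⟩ := mem_extraPart.1 hU
  obtain ⟨l', hl', m', hm', -, rfl⟩ := mem_extraPart.1 hU'
  refine farApart_prod_dotOrth hP hl hm hl' hm' fun h => hne ?_
  rw [Prod.mk.injEq] at h
  rw [h.1, h.2]

theorem ncard_extraPart [Finite F] (hP : IsPartialLineSpread ⊤ P) :
    (extraPart (Submodule.map (LinearMap.inr F (Fin n → F) (Fin n → F)) '' P)).ncard
      = P.ncard * (P.ncard - 1) := by
  classical
  have := finite_submodule F (Fin n → F)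
  obtain ⟨P', rfl⟩ := P.toFinite.exists_finset_coe
  have h1 : extraPart (Submodule.map (LinearMap.inr F (Fin n → F) (Fin n → F)) '' P')
      = (fun x : Submodule F (Fin n → F) × Submodule F (Fin n → F) =>
          Submodule.prod (dotOrth x.2) x.1) '' (P'.offDiag : Set _) := by
    ext U
    rw [mem_extraPart]
    constructor
    · rintro ⟨l, hl, m, hm, hne, h⟩
      exact ⟨(l, m), Finset.mem_coe.2 (Finset.mem_offDiag.2 ⟨hl, hm, hne⟩), h⟩
    · rintro ⟨⟨l, m⟩, h, h'⟩
      obtain ⟨hl, hm, hne⟩ := Finset.mem_offDiag.1 (Finset.mem_coe.1 h)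
      exact ⟨l, hl, m, hm, hne, h'⟩
  have hinj : Set.InjOn (fun x : Submodule F (Fin n → F) × Submodule F (Fin n → F) =>
      Submodule.prod (dotOrth x.2) x.1) (P'.offDiag : Set _) := by
    rintro ⟨l, m⟩ h ⟨l', m'⟩ h' heq
    obtain ⟨hl, hm, hlm⟩ := Finset.mem_offDiag.1 (Finset.mem_coe.1 h)
    obtain ⟨hl', hm', -⟩ := Finset.mem_offDiag.1 (Finset.mem_coe.1 h')
    simp only at hl hm hlm hl' hm' heq
    by_contra hne
    have h2 := farApart_prod_dotOrth hP hl hm hl' hm' hne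
    have h3 := (finrank_of_mem_extraPart hP (mem_extraPart.2 ⟨l, hl, m, hm, hlm, rfl⟩)).1
    rw [← heq, FarApart, inf_idem, h3] at h2
    omega
  rw [h1, Set.InjOn.ncard_image hinj, Set.ncard_coe_finset, Finset.offDiag_card,
    Set.ncard_coe_finset, Nat.mul_sub_one]

end Extra

theorem finrank_of_mem_baseCode {A₀ : Set (Matrix (Fin n) (Fin n) F)}
    {U : Submodule F (Ambient F n)} (hU : U ∈ baseCode A₀) : finrank F U = n := by
  rcases hU with ((⟨A, -, -, rfl⟩ | ⟨A, -, -, -, rfl⟩) | hU) | rfl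
  · exact finrank_liftL A
  · exact finrank_liftL' A
  · exact hU.1.2
  · exact finrank_spaceS

section Base

variable {M : Submodule F (Matrix (Fin n) (Fin n) F)}

theorem pairwise_farApart_liftedPart (hM : ∀ A ∈ M, A ≠ 0 → 2 ≤ A.rank) :
    (liftedPart (M : Set (Matrix (Fin n) (Fin n) F))).Pairwise FarApart := by
  rintro _ ⟨A, hA, -, rfl⟩ _ ⟨B, hB, -, rfl⟩ hne
  have h1 := hM _ (M.sub_mem hA hB) (sub_ne_zero.2 fun h => hne (by rw [h]))
  have h2 := finrank_liftL_inf_liftL_add_rank_le A B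
  rw [FarApart]
  omega

theorem pairwise_farApart_constantRankPart (hM : ∀ A ∈ M, A ≠ 0 → 2 ≤ A.rank) :
    (constantRankPart (M : Set (Matrix (Fin n) (Fin n) F))).Pairwise FarApart := by
  rintro _ ⟨A, hA, -, -, rfl⟩ _ ⟨B, hB, -, -, rfl⟩ hne
  have h1 := hM _ (M.sub_mem hA hB) (sub_ne_zero.2 fun h => hne (by rw [h]))
  have h2 := finrank_liftL'_inf_liftL'_add_rank_le A B
  rw [FarApart]
  omega

theorem pairwise_farApart_generatorPart [Finite F] :
    (generatorPart F n).Pairwise FarApart := by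
  intro U hU U' hU' hne
  exact hU.1.finrank_inf_add_two_le hU'.1 (hU.1.sameSystem_spaceS_iff.1 hU.2.1)
    (hU'.1.sameSystem_spaceS_iff.1 hU'.2.1) hne

theorem two_le_finrank_liftL'_inf_spaceS {A : Matrix (Fin n) (Fin n) F} (h2 : 2 ≤ A.rank)
    (h : A.rank ≤ n - 2) : 2 ≤ finrank F ↥(liftL' A ⊓ spaceS F n) := by
  have := finrank_liftL'_inf_spaceS A
  omega

theorem farApart_liftedPart_generatorPart (hn : 2 ≤ n) (hM : ∀ A ∈ M, A ≠ 0 → 2 ≤ A.rank)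
    (hsk : ∀ A, IsSkew A → A ∈ M) :
    ∀ U ∈ liftedPart (M : Set (Matrix (Fin n) (Fin n) F)), ∀ U' ∈ generatorPart F n,
      FarApart U U' := by
  rintro _ ⟨A, hA, hns, rfl⟩ U hU
  by_contra h
  rw [FarApart] at h
  exact hns (isSkew_of_finrank_liftL_inf hM hsk hA hU.1.1 (by omega))

theorem farApart_constantRankPart_generatorPart [Finite F] (hM : ∀ A ∈ M, A ≠ 0 → 2 ≤ A.rank)
    (hsk : ∀ A, IsSkew A → A ∈ M) :
    ∀ U ∈ constantRankPart (M : Set (Matrix (Fin n) (Fin n) F)), ∀ U' ∈ generatorPart F n,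
      FarApart U U' := by
  rintro _ ⟨A, hA, h2, h3, rfl⟩ U hU
  rcases two_le_finrank_inf_spaceS'_or hU with h | ⟨B, hB, h, rfl⟩
  · exact (farApart_of_inf_eq_bot hU.1.2 (liftL'_inf_spaceS' A) h).symm
  · have hne : A ≠ B := by
      rintro rfl
      omega
    have h1 := hM _ (M.sub_mem hA (hsk _ hB)) (sub_ne_zero.2 hne)
    have h2 := finrank_liftL'_inf_liftL'_add_rank_le A B
    rw [FarApart]
    omega

theorem farApart_generatorPart_spaceS [Finite F] (hn : 3 ≤ n) :
    ∀ U ∈ generatorPart F n, FarApart U (spaceS F n) := by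
  intro U hU
  rcases two_le_finrank_inf_spaceS'_or hU with h | ⟨B, hB, h, rfl⟩
  · refine farApart_of_inf_eq_bot hU.1.2 ?_ h
    rw [spaceS, spaceS', Submodule.prod_inf_prod, bot_inf_eq, inf_bot_eq, Submodule.prod_bot]
  · have := finrank_liftL'_inf_spaceS B
    rw [FarApart]
    omega

theorem farApart_liftedPart_constantRankPart :
    ∀ U ∈ liftedPart (M : Set (Matrix (Fin n) (Fin n) F)),
      ∀ U' ∈ constantRankPart (M : Set (Matrix (Fin n) (Fin n) F)), FarApart U U' := by
  rintro _ ⟨A, -, -, rfl⟩ _ ⟨B, -, h2, h3, rfl⟩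
  exact (farApart_of_inf_eq_bot (finrank_liftL' B) (liftL_inf_spaceS A)
    (two_le_finrank_liftL'_inf_spaceS h2 h3)).symm

theorem farApart_union_generatorPart [Finite F] (hn : 3 ≤ n) (hM : ∀ A ∈ M, A ≠ 0 → 2 ≤ A.rank)
    (hsk : ∀ A, IsSkew A → A ∈ M) :
    ∀ U ∈ liftedPart (M : Set (Matrix (Fin n) (Fin n) F)) ∪ constantRankPart M,
      ∀ U' ∈ generatorPart F n, FarApart U U' := by
  rintro U (hU | hU) U' hU'
  · exact farApart_liftedPart_generatorPart (by omega) hM hsk U hU U' hU'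
  · exact farApart_constantRankPart_generatorPart hM hsk U hU U' hU'

theorem farApart_union_spaceS [Finite F] (hn : 3 ≤ n) :
    ∀ U ∈ liftedPart (M : Set (Matrix (Fin n) (Fin n) F)) ∪ constantRankPart M ∪ generatorPart F n,
      ∀ U' ∈ ({spaceS F n} : Set (Submodule F (Ambient F n))), FarApart U U' := by
  rintro U ((⟨A, -, -, rfl⟩ | ⟨A, -, h2, h3, rfl⟩) | hU) _ rfl
  · rw [FarApart, liftL_inf_spaceS, finrank_bot]
    omega
  · have := finrank_liftL'_inf_spaceS A
    rw [FarApart]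
    omega
  · exact farApart_generatorPart_spaceS hn U hU

theorem pairwise_farApart_baseCode [Finite F] (hn : 3 ≤ n) (hM : ∀ A ∈ M, A ≠ 0 → 2 ≤ A.rank)
    (hsk : ∀ A, IsSkew A → A ∈ M) :
    (baseCode (M : Set (Matrix (Fin n) (Fin n) F))).Pairwise FarApart := by
  refine pairwise_union_farApart (pairwise_union_farApart (pairwise_union_farApart
    (pairwise_farApart_liftedPart hM) (pairwise_farApart_constantRankPart hM)
    farApart_liftedPart_constantRankPart) pairwise_farApart_generatorPart ?_)
    (Set.pairwise_singleton _ _) (farApart_union_spaceS hn)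
  exact farApart_union_generatorPart hn hM hsk

theorem farApart_baseCode_extraPart (hn : 4 ≤ n) {P : Set (Submodule F (Fin n → F))}
    (hP : IsPartialLineSpread ⊤ P) :
    ∀ U ∈ baseCode (M : Set (Matrix (Fin n) (Fin n) F)),
      ∀ U' ∈ extraPart (Submodule.map (LinearMap.inr F (Fin n → F) (Fin n → F)) '' P),
        FarApart U U' := by
  intro U hU X hX
  obtain ⟨h1, h2, h3⟩ := finrank_of_mem_extraPart hP hX
  rcases hU with ((⟨A, -, -, rfl⟩ | ⟨A, -, -, -, rfl⟩) | hU) | rfl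
  · exact (farApart_of_inf_eq_bot h1 (liftL_inf_spaceS A) h2.ge).symm
  · exact (farApart_of_inf_eq_bot h1 (liftL'_inf_spaceS' A) (by omega)).symm
  · obtain ⟨l, hl, m, hm, hne, rfl⟩ := mem_extraPart.1 hX
    rw [isPartialLineSpread_top_iff] at hP
    exact FarApart.symm (finrank_prod_inf_le (hP.1 m hm) (hP.2 hl hm hne) hU.1.1)
  · refine FarApart.symm ?_
    rw [FarApart]
    omega

variable {E : Type*} [Field E] [Algebra F E]

theorem ncard_baseCode [Finite F] (hn : 3 ≤ n) (hodd : Odd n) (b : Basis (Fin n) F E) :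
    ((baseCode (mrdCode b : Set (Matrix (Fin n) (Fin n) F))).ncard : ℚ)
        + (spreadSize (Nat.card F) n : ℚ) * ((spreadSize (Nat.card F) n : ℚ) - 1)
      = codeSize (Nat.card F) n := by
  have := finite_submodule F (Ambient F n)
  have hM : ∀ A ∈ mrdCode b, A ≠ 0 → 2 ≤ A.rank := fun A => two_le_rank_of_mem_mrdCode b
  have hsk : ∀ A, IsSkew A → A ∈ mrdCode b := fun A hA => hA.mem_mrdCode b
  have hfr : ∀ U ∈ baseCode (mrdCode b : Set (Matrix (Fin n) (Fin n) F)), finrank F U = n :=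
    fun U => finrank_of_mem_baseCode
  have d1 := disjoint_of_farApart (fun U hU => hfr U (Or.inl (Or.inl (Or.inl hU))))
    (farApart_liftedPart_constantRankPart (M := mrdCode b))
  have d2 := disjoint_of_farApart (fun U hU => hfr U (Or.inl (Or.inl hU)))
    (farApart_union_generatorPart hn hM hsk)
  have d3 := disjoint_of_farApart (fun U hU => hfr U (Or.inl hU))
    (farApart_union_spaceS (M := mrdCode b) hn)
  rw [baseCode, Set.ncard_union_eq d3, Set.ncard_union_eq d2, Set.ncard_union_eq d1,
    Set.ncard_singleton]
  push_cast
  rw [ncard_liftedPart, ncard_constantRankPart, ncard_generatorPart hn hodd, codeSize]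
  ring

end Base

theorem isConstantDimensionCode_union [Finite F] {E : Type*} [Field E] [Algebra F E] (hn : 5 ≤ n)
    (b : Basis (Fin n) F E) {P : Set (Submodule F (Fin n → F))}
    (hP : IsPartialLineSpread ⊤ P) (hcard : 3 ≤ P.ncard) :
    IsConstantDimensionCode (baseCode (mrdCode b : Set (Matrix (Fin n) (Fin n) F)) ∪
        extraPart (Submodule.map (LinearMap.inr F (Fin n → F) (Fin n → F)) '' P)) (2 * n)
      ((baseCode (mrdCode b : Set (Matrix (Fin n) (Fin n) F))).ncard
        + P.ncard * (P.ncard - 1)) 4 n := by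
  have := finite_submodule F (Ambient F n)
  have := finite_submodule F (Fin n → F)
  set X := extraPart (Submodule.map (LinearMap.inr F (Fin n → F) (Fin n → F)) '' P)
  have hfar := farApart_baseCode_extraPart (M := mrdCode b) (by omega) hP
  have hfr : ∀ U ∈ baseCode (mrdCode b : Set (Matrix (Fin n) (Fin n) F)) ∪ X,
      finrank F U = n := by
    rintro U (hU | hU)
    · exact finrank_of_mem_baseCode hU
    · exact (finrank_of_mem_extraPart hP hU).1
  have hpair := pairwise_union_farApart (pairwise_farApart_baseCode (by omega)
    (fun A => two_le_rank_of_mem_mrdCode b) fun A hA => hA.mem_mrdCode b)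
    (pairwise_farApart_extraPart hP) hfar
  refine ⟨finrank_ambient, hfr, Set.toFinite _, ?_, ?_, ?_⟩
  · rw [Set.ncard_union_eq (disjoint_of_farApart (fun U hU => hfr U (Or.inl hU)) hfar),
      ncard_extraPart hP]
  · -- Two of the extra spaces with the same line `l` attain the distance.
    obtain ⟨l, m, m', hl, hm, hm', h1, h2, h3⟩ := (Set.two_lt_ncard_iff (Set.toFinite P)).1 hcard
    have hU : Submodule.prod (dotOrth m) l ∈ X := mem_extraPart.2 ⟨l, hl, m, hm, h1, rfl⟩
    have hU' : Submodule.prod (dotOrth m') l ∈ X := mem_extraPart.2 ⟨l, hl, m', hm', h2, rfl⟩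
    have h4 := finrank_prod_dotOrth_inf hP hl hm hm' h3
    refine ⟨_, Or.inr hU, _, Or.inr hU', fun h => ?_, ?_⟩
    · rw [h, inf_idem, hfr _ (Or.inr hU')] at h4
      omega
    · rw [subspaceDist_eq (hfr _ (Or.inr hU)) (hfr _ (Or.inr hU'))]
      omega
  · rintro t ⟨U, hU, U', hU', hne, rfl⟩
    have h := hpair hU hU' hne
    rw [FarApart] at h
    rw [subspaceDist_eq (hfr U hU) (hfr U' hU')]
    omega

theorem three_le_spreadSize {q n : ℕ} (hq : 2 ≤ q) (hn : 5 ≤ n) : 3 ≤ spreadSize q n := by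
  have h1 : q ^ (2 * 1 + 1) ≤ ∑ i ∈ Finset.Icc 1 ((n - 3) / 2), q ^ (2 * i + 1) :=
    Finset.single_le_sum (f := fun i => q ^ (2 * i + 1)) (fun _ _ => Nat.zero_le _)
      (Finset.mem_Icc.2 ⟨le_rfl, by omega⟩)
  have h2 : 2 ^ 3 ≤ q ^ (2 * 1 + 1) := Nat.pow_le_pow_left hq 3
  rw [spreadSize]
  omega

end Code
end SubspaceCode

open SubspaceCode

theorem theorem3p4 (n : ℕ) (hn : 5 ≤ n) (hodd : Odd n) (q : ℕ)
    (F : Type*) [Field F] [Finite F] (hF : Nat.card F = q) :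
    IsGreatest {k | ∃ P : Set (Submodule F (Ambient F n)),
        IsPartialLineSpread (spaceS F n) P ∧ P.ncard = k} (spreadSize q n) ∧
    ∃ (A₀ : Submodule F (Matrix (Fin n) (Fin n) F)) (P : Set (Submodule F (Ambient F n))) (M : ℕ),
      IsMRD (A₀ : Set (Matrix (Fin n) (Fin n) F)) 2 ∧ (∀ A, IsSkew A → A ∈ A₀) ∧
      IsPartialLineSpread (spaceS F n) P ∧ P.ncard = spreadSize q n ∧
      (extraPart P).ncard = spreadSize q n * (spreadSize q n - 1) ∧
      Disjoint (baseCode (A₀ : Set (Matrix (Fin n) (Fin n) F))) (extraPart P) ∧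
      (M : ℚ) = codeSize q n ∧
      IsConstantDimensionCode
        (baseCode (A₀ : Set (Matrix (Fin n) (Fin n) F)) ∪ extraPart P) (2 * n) M 4 n := by
  subst hF
  obtain ⟨m, hm⟩ : ∃ m, n = 2 * m + 3 := by
    obtain ⟨k, hk⟩ := hodd
    exact ⟨k - 1, by omega⟩
  have hex := exists_isPartialLineSpread (F := F) m
  rw [← hm] at hex
  obtain ⟨P, hP, hcard⟩ := hex
  have h3 := three_le_spreadSize (Finite.one_lt_card (α := F)) hn
  have hP' := hP.map (f := LinearMap.inr F (Fin n → F) (Fin n → F)) LinearMap.inr_injective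
  rw [← spaceS_eq_map_top] at hP'
  have hcard' := (ncard_image_map P (f := LinearMap.inr F (Fin n → F) (Fin n → F))
    LinearMap.inr_injective).trans hcard
  refine ⟨⟨⟨_, hP', hcard'⟩, ?_⟩, ?_⟩
  · rintro k ⟨P₁, hP₁, rfl⟩
    obtain ⟨P₀, hP₀, rfl⟩ := exists_eq_image_map_inr hP₁
    rw [ncard_image_map _ LinearMap.inr_injective]
    exact ncard_le_spreadSize hm hP₀
  · obtain ⟨E, _, _, ⟨b⟩⟩ := exists_field_extension_basis F (show n ≠ 0 by omega)
    refine ⟨mrdCode b, _, _, isMRD_mrdCode b (by omega), fun A hA => hA.mem_mrdCode b, hP', hcard',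
      ?_, ?_, ?_, isConstantDimensionCode_union hn b hP (hcard ▸ h3)⟩
    · rw [ncard_extraPart hP, hcard]
    · exact disjoint_of_farApart (fun U => finrank_of_mem_baseCode)
        (farApart_baseCode_extraPart (by omega) hP)
    · rw [← ncard_baseCode (by omega) hodd b, hcard]
      push_cast [Nat.cast_sub (show 1 ≤ spreadSize (Nat.card F) n by omega)]
      rfl
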